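/- Let $n\ge 1$, let $\Theta=(\Theta^{\mu\nu})_{0\le\mu,\nu\le n-1}$ be a real skew-symmetric matrix, and let $\star$ be the Moyal product $$(f\star h)(x)=\frac1{(2\pi)^n}\int\!\!\int f\bigl(x-\tfrac12\Theta u\bigr)\,h(x+v)\,e^{-iu\cdot v}\,d^nv\,d^nu$$ (iterated integral over $v$ first, for $h$ Schwartz and $f$ continuous of polynomial growth). Let $\gamma^0,\dots,\gamma^{n-1}$ be $2^{\lfloor n/2\rfloor}\times 2^{\lfloor n/2\rfloor}$ Dirac matrices of signature $(-,+,\dots,+)$, that is, $\gamma^\mu\gamma^\nu+\gamma^\nu\gamma^\mu=2\eta^{\mu\nu}$ with $\gamma^0$ anti-Hermitian and $\gamma^1,\dots,\gamma^{n-1}$ Hermitian. The Moyal–Minkowski temporal Lorentzian spectral triple $(\mathcal A,\widetilde{\mathcal A},\mathcal H,D,\mathcal T)$ consists of the Hilbert space $\mathcal H=L^2(\mathbb R^{1,n-1})\otimes\mathbb C^{2^{\lfloor n/2\rfloor}}$; the algebra $\mathcal A=(\mathcal S(\mathbb R^{1,n-1}),\star)$ of Schwartz functions and its unitization $\widetilde{\mathcal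 A}=(\mathcal B(\mathbb R^{1,n-1}),\star)$, where $\mathcal B$ is the space of smooth functions bounded together with all their derivatives, both acting on $\mathcal H$ by left Moyal multiplication $\psi\mapsto a\star\psi$ (extended continuously from Schwartz spinors); the Dirac operator $D=-i\,\partial_\mu\otimes\gamma^\mu$; and the time operator $\mathcal T=x^0$, acting by $\psi\mapsto x^0\star\psi$. Here $D$ and $\mathcal T$ are the closures of these operators on Schwartz spinors. The triple is said to have commutative time if the self-adjoint operator $S=(1+\mathcal T^2)^{1/2}$ and the commutator $[D,S]$ (the closure of $DS-SD$ on its natural domain) commute with every $a\in\widetilde{\mathcal A}$, where a bounded operator $a$ commutes with an unbounded operator $X$ if $a$ maps $\mathrm{Dom}\,X$ into itself and $aX\psi=Xa\psi$ for all $\psi\in\mathrm{Dom}\,X$. Then the Moyal–Minkowski triple has commutative time if and only if $$\Theta^{0\mu}=\Theta^{\mu0}=0\qquad\text{for all }\mu=0,\dots,n-1 .$$ -/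

import Mathlib

open MeasureTheory
open scoped SchwartzMap ContDiff Matrix

noncomputable section

/-! ## Unbounded operators on a Hilbert space -/

section Operators

variable {H : Type*} [NormedAddCommGroup H] [InnerProductSpace ℂ H]

/-- The composition `X Y` of two unbounded operators, on its natural domain
`{x ∈ Dom Y | Y x ∈ Dom X}`. -/
def opMul (X Y : H →ₗ.[ℂ] H) : H →ₗ.[ℂ] H where
  domain := (X.domain.comap Y.toFun).map Y.domain.subtype
  toFun :=
    { toFun := fun x => X ⟨Y ⟨x, by
          obtain ⟨y, -, h⟩ := x.2
          exact h ▸ y.2⟩, by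
          obtain ⟨x, y, hy, rfl⟩ := x
          exact hy⟩
      map_add' := fun x y => by
        rw [← X.map_add]
        congr 1
        apply Subtype.ext
        exact Y.map_add ⟨x, _⟩ ⟨y, _⟩
      map_smul' := fun c x => by
        rw [RingHom.id_apply, ← X.map_smul]
        congr 1
        apply Subtype.ext
        exact Y.map_smul c ⟨x, _⟩ }

theorem mem_opMul_domain {X Y : H →ₗ.[ℂ] H} {x : H} :
    x ∈ (opMul X Y).domain ↔ ∃ h : x ∈ Y.domain, Y ⟨x, h⟩ ∈ X.domain := by
  constructor
  · rintro ⟨y, hy, rfl⟩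
    exact ⟨y.2, hy⟩
  · rintro ⟨h, hx⟩
    exact ⟨⟨x, h⟩, hx, rfl⟩

theorem opMul_apply {X Y : H →ₗ.[ℂ] H} {x : H} (h : x ∈ Y.domain)
    (h' : Y ⟨x, h⟩ ∈ X.domain) :
    opMul X Y ⟨x, mem_opMul_domain.2 ⟨h, h'⟩⟩ = X ⟨Y ⟨x, h⟩, h'⟩ := rfl

/-- The commutator `[X, Y]`: the closure of `X Y - Y X`, the latter being defined on
`Dom (X Y) ∩ Dom (Y X)`. -/
def opCommutator (X Y : H →ₗ.[ℂ] H) : H →ₗ.[ℂ] H :=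
  (opMul X Y - opMul Y X).closure

/-- A bounded operator `a` commutes with an unbounded operator `X` when `a X ⊆ X a`: it maps
`Dom X` to itself, and `X a x = a X x` for all `x ∈ Dom X`. -/
def CommutesWith (a : H →L[ℂ] H) (X : H →ₗ.[ℂ] H) : Prop :=
  ∀ x : X.domain, ∃ h : a x ∈ X.domain, X ⟨a x, h⟩ = a (X x)

/-- `S = (1 + T ^ 2) ^ (1 / 2)`: the operator `S` is self-adjoint, nonnegative, and
`S ^ 2 = 1 + T ^ 2` as unbounded operators (equality of domains included). When `T` is
self-adjoint there is exactly one such `S`. -/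
structure IsSqrtOneAddSq [CompleteSpace H] (T S : H →ₗ.[ℂ] H) : Prop where
  selfAdjoint : IsSelfAdjoint S
  nonneg : ∀ x : S.domain, 0 ≤ (inner ℂ (x : H) (S x)).re
  sq_eq : opMul S S = (LinearMap.id : H →ₗ[ℂ] H) +ᵥ opMul T T

end Operators

/-- The data `(𝒜, 𝒜~, H, D, T)` of a temporal Lorentzian spectral triple; the two algebras are
given by the bounded operators on `H` that represent their elements. -/
structure TemporalTriple (H : Type*) [NormedAddCommGroup H] [InnerProductSpace ℂ H] where
  /-- the nonunital algebra -/
  algebra : Set (H →L[ℂ] H)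
  /-- its preferred unitization -/
  unitization : Set (H →L[ℂ] H)
  /-- the Dirac operator -/
  dirac : H →ₗ.[ℂ] H
  /-- the global time -/
  time : H →ₗ.[ℂ] H

/-- Commutative time: `(1 + T ^ 2) ^ (1 / 2)` and `[D, (1 + T ^ 2) ^ (1 / 2)]` commute with all
elements of the unitization. -/
def TemporalTriple.HasCommutativeTime {H : Type*} [NormedAddCommGroup H]
    [InnerProductSpace ℂ H] [CompleteSpace H] (t : TemporalTriple H) : Prop :=
  ∃ S : H →ₗ.[ℂ] H, IsSqrtOneAddSq t.time S ∧
    ∀ a ∈ t.unitization, CommutesWith a S ∧ CommutesWith a (opCommutator t.dirac S)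

/-! ## The Moyal–Minkowski spacetime -/

section Moyal

variable {n : ℕ}

/-- The coordinate space of the Minkowski spacetime `ℝ^{1,n-1}`; the Minkowski density is the
Lebesgue measure. -/
abbrev MinkowskiSpace (n : ℕ) : Type := EuclideanSpace ℝ (Fin n)

/-- The fibre `ℂ^(2^⌊n/2⌋)` of the spinor bundle. -/
abbrev SpinorFibre (n : ℕ) : Type := EuclideanSpace ℂ (Fin (2 ^ (n / 2)))

/-- The Hilbert space `L²(ℝ^{1,n-1}) ⊗ ℂ^(2^⌊n/2⌋)` of square integrable spinors. -/
abbrev SpinorL2 (n : ℕ) : Type := Lp (SpinorFibre n) 2 (volume : Measure (MinkowskiSpace n))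

/-- Schwartz spinors. -/
abbrev SpinorSchwartz (n : ℕ) : Type := 𝓢(MinkowskiSpace n, SpinorFibre n)

/-- The (spinor-componentwise) Moyal product
`(f ⋆ h)(x) = (2π)⁻ⁿ ∫ ∫ f(x - Θu/2) h(x + v) e^{-i u·v} dⁿv dⁿu`, the integral over `v` being
taken first. For `h` Schwartz that inner integral is a Schwartz function of `u`, so the iterated
integral converges absolutely for every continuous `f` of polynomial growth. -/
def moyalProd (Θ : Matrix (Fin n) (Fin n) ℝ) (f : MinkowskiSpace n → ℂ)
    (h : MinkowskiSpace n → SpinorFibre n) (x : MinkowskiSpace n) : SpinorFibre n :=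
  (((2 * Real.pi) ^ n)⁻¹ : ℝ) • ∫ u : MinkowskiSpace n,
    f (x - (1 / 2 : ℝ) • Matrix.toEuclideanLin Θ u) •
      ∫ v : MinkowskiSpace n, Complex.exp (-(Complex.I * (inner ℝ u v : ℝ))) • h (x + v)

/-- The closure in `L²` of an operator given on the Schwartz spinors: its graph is the closure of
`{(ψ, op ψ) | ψ Schwartz, op ψ ∈ L²}` (for a linear `op` that set is a subspace, and the span
below changes nothing). -/
def closureOfSchwartzOp (op : SpinorSchwartz n → MinkowskiSpace n → SpinorFibre n) :
    SpinorL2 n →ₗ.[ℂ] SpinorL2 n :=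
  (Submodule.span ℂ {p : SpinorL2 n × SpinorL2 n |
    ∃ ψ : SpinorSchwartz n, p.1 = ψ.toLp 2 volume ∧
      (p.2 : MinkowskiSpace n → SpinorFibre n) =ᵐ[volume] op ψ}).topologicalClosure.toLinearPMap

/-- The bounded operator `A` is `π(f) = L(f) ⊗ 1`, that is, the continuous extension to `L²` of
left Moyal multiplication by `f` on the Schwartz spinors. -/
def IsLeftMoyal (Θ : Matrix (Fin n) (Fin n) ℝ) (f : MinkowskiSpace n → ℂ)
    (A : SpinorL2 n →L[ℂ] SpinorL2 n) : Prop :=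
  ∀ ψ : SpinorSchwartz n,
    (A (ψ.toLp 2 volume) : MinkowskiSpace n → SpinorFibre n) =ᵐ[volume] moyalProd Θ f ψ

/-- The space `ℬ` of smooth functions that are bounded together with all their derivatives. -/
def IsSmoothBounded (f : MinkowskiSpace n → ℂ) : Prop :=
  ContDiff ℝ ∞ f ∧ ∀ k : ℕ, ∃ C : ℝ, ∀ x, ‖iteratedFDeriv ℝ k f x‖ ≤ C

/-- The flat Dirac matrices `γ⁰, …, γ^{n-1}` of signature `(-,+,…,+)`: they satisfy the Clifford
relations, `γ⁰` is anti-Hermitian and the others are Hermitian. -/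
structure IsDiracMatrices [NeZero n]
    (γ : Fin n → Matrix (Fin (2 ^ (n / 2))) (Fin (2 ^ (n / 2))) ℂ) : Prop where
  time_sq : γ 0 * γ 0 = -1
  space_sq : ∀ μ, μ ≠ 0 → γ μ * γ μ = 1
  anticomm : ∀ μ ν, μ ≠ ν → γ μ * γ ν + γ ν * γ μ = 0
  time_antiHermitian : (γ 0)ᴴ = -γ 0
  space_hermitian : ∀ μ, μ ≠ 0 → (γ μ)ᴴ = γ μ

/-- The Dirac operator `-i ∂_μ ⊗ γ^μ` on Schwartz spinors. -/
def flatDirac (γ : Fin n → Matrix (Fin (2 ^ (n / 2))) (Fin (2 ^ (n / 2))) ℂ)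
    (ψ : SpinorSchwartz n) (x : MinkowskiSpace n) : SpinorFibre n :=
  -Complex.I • ∑ μ, Matrix.toEuclideanLin (γ μ) (fderiv ℝ ψ x (EuclideanSpace.single μ 1))

/-- The Moyal–Minkowski triple `((𝓢, ⋆), (ℬ, ⋆), L² ⊗ ℂ^(2^⌊n/2⌋), -i ∂_μ ⊗ γ^μ, x⁰)`. All
functions, the unbounded coordinate function `x⁰` included, act by left Moyal multiplication. -/
def moyalMinkowski [NeZero n] (Θ : Matrix (Fin n) (Fin n) ℝ)
    (γ : Fin n → Matrix (Fin (2 ^ (n / 2))) (Fin (2 ^ (n / 2))) ℂ) :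
    TemporalTriple (SpinorL2 n) where
  algebra := {A | ∃ f : 𝓢(MinkowskiSpace n, ℂ), IsLeftMoyal Θ f A}
  unitization := {A | ∃ f : MinkowskiSpace n → ℂ, IsSmoothBounded f ∧ IsLeftMoyal Θ f A}
  dirac := closureOfSchwartzOp (flatDirac γ)
  time := closureOfSchwartzOp fun ψ => moyalProd Θ (fun x => ((x 0 : ℝ) : ℂ)) ψ

end Moyal

end

/-! Left Moyal multiplication by `x⁰` is the operator `L = x⁰ + (i/2) Θ^{0ν} ∂_ν`, and left Moyal
multiplication by the plane wave `e^{i⟨k, x⟩}` is a unitary `W` that shifts it by a constant: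
`L W = W (L + c)` with `c = ½ ∑ ν, k_ν (Θ^{ν0} - Θ^{0ν})`. If `(1 + T²)^{1/2}` commutes with `W`, so
does `T²`, hence `2 c L + c² = 0`; adding the same identity for `-k` gives `c = 0`, for every `k`.

Conversely, if `Θ^{0·} = Θ^{·0} = 0` then `T` is multiplication by `x⁰`, so `S = (1 + T²)^{1/2}` is
multiplication by a function of `x⁰`, and `[D, S]` is the bounded operator given by Clifford
multiplication with the differential of that function. Left Moyal multiplications commute with the
constant matrices and with the functions `e^{ikx⁰}`, and therefore, by Fourier inversion, with all
smooth functions of `x⁰`. -/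

open Filter Topology
open scoped LineDeriv FourierTransform ENNReal

/-! ## Graphs of unbounded operators -/

section Graph

variable {R E F : Type*} [Ring R] [AddCommGroup E] [Module R E] [AddCommGroup F] [Module R F]
  {X Y : E →ₗ.[R] F} {x : E} {y z : F}

theorem mem_graph_iff_exists_mem_domain :
    (x, y) ∈ X.graph ↔ ∃ h : x ∈ X.domain, X ⟨x, h⟩ = y := by
  simp [LinearPMap.mem_graph_iff]

theorem mem_graph_sub_iff :
    (x, z) ∈ (X - Y).graph ↔ ∃ y y', (x, y) ∈ X.graph ∧ (x, y') ∈ Y.graph ∧ y - y' = z := by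
  simp only [mem_graph_iff_exists_mem_domain]
  constructor
  · rintro ⟨hx, rfl⟩
    exact ⟨_, _, ⟨hx.1, rfl⟩, ⟨hx.2, rfl⟩, rfl⟩
  · rintro ⟨_, _, ⟨hX, rfl⟩, ⟨hY, rfl⟩, rfl⟩
    exact ⟨⟨hX, hY⟩, rfl⟩

theorem mem_graph_vadd_iff {f : E →ₗ[R] F} :
    (x, z) ∈ (f +ᵥ X).graph ↔ (x, z - f x) ∈ X.graph := by
  simp only [mem_graph_iff_exists_mem_domain, eq_sub_iff_add_eq']
  rfl

theorem mem_graph_toPMap_top_iff {f : E →ₗ[R] F} : (x, y) ∈ (f.toPMap ⊤).graph ↔ f x = y := by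
  simp [LinearPMap.mem_graph_iff]

end Graph

section Closure

variable {E F : Type*} [NormedAddCommGroup E] [NormedSpace ℂ E] [NormedAddCommGroup F]
  [NormedSpace ℂ F]

theorem isClosed_toPMap_top (B : E →L[ℂ] F) : ((B : E →ₗ[ℂ] F).toPMap ⊤).IsClosed := by
  have hgraph : (((B : E →ₗ[ℂ] F).toPMap ⊤).graph : Set (E × F)) = {p | B p.1 = p.2} :=
    Set.ext fun _ => mem_graph_toPMap_top_iff
  rw [LinearPMap.IsClosed, hgraph]
  exact isClosed_eq (by fun_prop) continuous_snd

theorem closure_eq_toPMap_top {X : E →ₗ.[ℂ] F} {B : E →L[ℂ] F}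
    (hX : X ≤ (B : E →ₗ[ℂ] F).toPMap ⊤) (hd : Dense (X.domain : Set E)) :
    X.closure = (B : E →ₗ[ℂ] F).toPMap ⊤ := by
  have hB := isClosed_toPMap_top B
  have hclosable : X.IsClosable := hB.isClosable.leIsClosable hX
  have hle : X.closure ≤ (B : E →ₗ[ℂ] F).toPMap ⊤ := by
    rw [← LinearPMap.le_graph_iff, ← hclosable.graph_closure_eq_closure_graph]
    exact Submodule.topologicalClosure_minimal _ (LinearPMap.le_graph_of_le hX) hB
  refine LinearPMap.eq_of_le_of_domain_eq hle (eq_top_iff.2 fun x _ => ?_)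
  have hclosed : IsClosed {x : E | (x, B x) ∈ X.closure.graph} :=
    hclosable.closure_isClosed.preimage (continuous_id.prodMk B.continuous)
  refine LinearPMap.mem_domain_of_mem_graph (hclosed.closure_subset_iff.2 (fun y hy => ?_) (hd x))
  have hy' := X.mem_graph ⟨y, hy⟩
  rw [← mem_graph_toPMap_top_iff.1 (LinearPMap.le_graph_of_le hX hy')] at hy'
  exact LinearPMap.le_graph_of_le X.le_closure hy'

end Closure

section Commutation

variable {H : Type*} [NormedAddCommGroup H] [InnerProductSpace ℂ H] {a : H →L[ℂ] H}
  {X Y : H →ₗ.[ℂ] H}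

theorem mem_graph_opMul_iff {x z : H} :
    (x, z) ∈ (opMul X Y).graph ↔ ∃ y, (x, y) ∈ Y.graph ∧ (y, z) ∈ X.graph := by
  simp only [mem_graph_iff_exists_mem_domain]
  constructor
  · rintro ⟨h, rfl⟩
    obtain ⟨hx, hy⟩ := mem_opMul_domain.1 h
    exact ⟨_, ⟨hx, rfl⟩, hy, opMul_apply hx hy⟩
  · rintro ⟨_, ⟨hx, rfl⟩, hy, rfl⟩
    exact ⟨mem_opMul_domain.2 ⟨hx, hy⟩, opMul_apply hx hy⟩

theorem commutesWith_iff_graph :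
    CommutesWith a X ↔ ∀ x y, (x, y) ∈ X.graph → (a x, a y) ∈ X.graph := by
  simp only [mem_graph_iff_exists_mem_domain]
  constructor
  · rintro h x _ ⟨hx, rfl⟩
    exact h ⟨x, hx⟩
  · exact fun h x => h x _ ⟨x.2, rfl⟩

theorem CommutesWith.opMul (hX : CommutesWith a X) (hY : CommutesWith a Y) :
    CommutesWith a (opMul X Y) := by
  rw [commutesWith_iff_graph] at hX hY ⊢
  intro x z hxz
  obtain ⟨y, hxy, hyz⟩ := mem_graph_opMul_iff.1 hxz
  exact mem_graph_opMul_iff.2 ⟨a y, hY x y hxy, hX y z hyz⟩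

theorem CommutesWith.of_id_vadd (h : CommutesWith a ((LinearMap.id : H →ₗ[ℂ] H) +ᵥ X)) :
    CommutesWith a X := by
  rw [commutesWith_iff_graph] at h ⊢
  intro x y hxy
  have hax := h x (y + x) (mem_graph_vadd_iff.2 (by rwa [LinearMap.id_apply, add_sub_cancel_right]))
  rwa [mem_graph_vadd_iff, LinearMap.id_apply, map_add, add_sub_cancel_right] at hax

theorem commutesWith_toPMap_top_iff {B : H →L[ℂ] H} :
    CommutesWith a ((B : H →ₗ[ℂ] H).toPMap ⊤) ↔ Commute a B := by
  simp only [commutesWith_iff_graph, mem_graph_toPMap_top_iff, ContinuousLinearMap.coe_coe,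
    forall_eq']
  exact ⟨fun h => ContinuousLinearMap.ext fun x => (h x).symm,
    fun h x => (DFunLike.congr_fun h.eq x).symm⟩

end Commutation

/-! ## Multiplication operators -/

section JapaneseBracket

/-- The Japanese bracket `⟨t⟩ = (1 + t ^ 2) ^ (1 / 2)`. -/
noncomputable def japaneseBracket (t : ℝ) : ℝ := √(1 + t ^ 2)

theorem japaneseBracket_pos (t : ℝ) : 0 < japaneseBracket t := Real.sqrt_pos.2 (by positivity)

theorem japaneseBracket_sq (t : ℝ) : japaneseBracket t ^ 2 = 1 + t ^ 2 :=
  Real.sq_sqrt (by positivity)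

theorem continuous_japaneseBracket : Continuous japaneseBracket := by
  unfold japaneseBracket
  fun_prop

theorem norm_inv_japaneseBracket_le_one (t : ℝ) : ‖(japaneseBracket t)⁻¹‖ ≤ 1 := by
  rw [norm_inv, Real.norm_of_nonneg (japaneseBracket_pos t).le]
  exact inv_le_one_of_one_le₀ (Real.one_le_sqrt.2 (by nlinarith [sq_nonneg t]))

theorem norm_mul_inv_japaneseBracket_le_one (t : ℝ) : ‖t * (japaneseBracket t)⁻¹‖ ≤ 1 := by
  rw [norm_mul, norm_inv, Real.norm_of_nonneg (japaneseBracket_pos t).le, ← div_eq_mul_inv,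
    div_le_one₀ (japaneseBracket_pos t)]
  exact Real.abs_le_sqrt (by linarith)

end JapaneseBracket

section MultiplicationOperator

variable {α : Type*} [MeasurableSpace α] {μ : Measure α} {E : Type*} [NormedAddCommGroup E]
  [InnerProductSpace ℂ E]

/-- The multiplication operator `ψ ↦ g ψ` on its maximal domain `{ψ ∈ L² | g ψ ∈ L²}`. -/
noncomputable def mulOp (g : α → ℂ) : Lp E 2 μ →ₗ.[ℂ] Lp E 2 μ :=
  Submodule.toLinearPMap
    { carrier := {p | p.2 =ᵐ[μ] fun x => g x • p.1 x}
      add_mem' := fun {p q} hp hq => by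
        filter_upwards [hp, hq, Lp.coeFn_add p.1 q.1, Lp.coeFn_add p.2 q.2] with x h1 h2 h3 h4
        simp only [Prod.fst_add, Prod.snd_add, h3, h4, Pi.add_apply, h1, h2, smul_add]
      zero_mem' := by
        filter_upwards [Lp.coeFn_zero E 2 μ] with x h
        simp only [Prod.fst_zero, Prod.snd_zero, h, Pi.zero_apply, smul_zero]
      smul_mem' := fun c p hp => by
        filter_upwards [hp, Lp.coeFn_smul c p.1, Lp.coeFn_smul c p.2] with x h1 h3 h4
        simp only [Prod.smul_fst, Prod.smul_snd, h3, h4, Pi.smul_apply, h1, smul_comm c] }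

theorem mem_graph_mulOp_iff {g : α → ℂ} {x y : Lp E 2 μ} :
    (x, y) ∈ (mulOp g).graph ↔ y =ᵐ[μ] fun t => g t • x t := by
  rw [mulOp, Submodule.toLinearPMap_graph_eq]
  · rfl
  · rintro ⟨x, y⟩ h (rfl : x = 0)
    refine Lp.ext ?_
    filter_upwards [h, Lp.coeFn_zero E 2 μ] with t h1 h2
    rw [h1, h2, Pi.zero_apply, smul_zero]

theorem opMul_mulOp_self {g : α → ℂ} (hg : AEStronglyMeasurable g μ) :
    opMul (mulOp (μ := μ) (E := E) g) (mulOp g) = mulOp (g ^ 2) := by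
  refine LinearPMap.eq_of_eq_graph (Submodule.ext fun ⟨x, z⟩ => ?_)
  simp only [mem_graph_opMul_iff, mem_graph_mulOp_iff]
  constructor
  · rintro ⟨y, hy, hz⟩
    filter_upwards [hy, hz] with t h1 h2
    rw [h2, h1, smul_smul, Pi.pow_apply, sq]
  · intro hz
    have hgx : MemLp (fun t => g t • x t) 2 μ := by
      refine ((Lp.memLp x).norm.add (Lp.memLp z).norm).mono
        (hg.smul (Lp.aestronglyMeasurable x)) ?_
      filter_upwards [hz] with t ht
      rw [Pi.add_apply, ht, norm_smul, norm_smul, Pi.pow_apply, norm_pow,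
        Real.norm_of_nonneg (by positivity)]
      nlinarith [norm_nonneg (x t), sq_nonneg (‖g t‖ - 1), norm_nonneg (g t)]
    refine ⟨hgx.toLp _, hgx.coeFn_toLp, ?_⟩
    filter_upwards [hz, hgx.coeFn_toLp] with t h1 h2
    rw [h1, h2, smul_smul, Pi.pow_apply, sq]

theorem id_vadd_mulOp (g : α → ℂ) :
    (LinearMap.id : Lp E 2 μ →ₗ[ℂ] Lp E 2 μ) +ᵥ mulOp g =
      (mulOp (1 + g) : Lp E 2 μ →ₗ.[ℂ] Lp E 2 μ) := by
  refine LinearPMap.eq_of_eq_graph (Submodule.ext fun ⟨x, z⟩ => ?_)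
  rw [mem_graph_vadd_iff, mem_graph_mulOp_iff, mem_graph_mulOp_iff, LinearMap.id_apply]
  refine eventually_congr ?_
  filter_upwards [Lp.coeFn_sub z x] with t ht
  rw [ht, Pi.sub_apply, Pi.add_apply, Pi.one_apply, add_smul, one_smul, sub_eq_iff_eq_add']

theorem inner_eq_inner_of_mem_graph_mulOp {f : α → ℝ} {x y x' y' : Lp E 2 μ}
    (h : (x, y) ∈ (mulOp fun t => (f t : ℂ)).graph)
    (h' : (x', y') ∈ (mulOp fun t => (f t : ℂ)).graph) : inner ℂ y x' = inner ℂ x y' := by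
  rw [L2.inner_def, L2.inner_def]
  refine integral_congr_ae ?_
  filter_upwards [mem_graph_mulOp_iff.1 h, mem_graph_mulOp_iff.1 h'] with t h1 h2
  rw [h1, h2, inner_smul_left, inner_smul_right, Complex.conj_ofReal]

theorem re_inner_mulOp_nonneg {f : α → ℝ} (hf : ∀ t, 0 ≤ f t)
    (x : (mulOp (μ := μ) (E := E) fun t => (f t : ℂ)).domain) :
    0 ≤ (inner ℂ (x : Lp E 2 μ) (mulOp (fun t => (f t : ℂ)) x)).re := by
  rw [L2.inner_def, ← RCLike.re_eq_complex_re, ← integral_re (L2.integrable_inner _ _)]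
  refine integral_nonneg_of_ae ?_
  filter_upwards [mem_graph_mulOp_iff.1 ((mulOp fun t => (f t : ℂ)).mem_graph x)] with t ht
  rw [ht, inner_smul_right, RCLike.re_eq_complex_re, Complex.re_ofReal_mul]
  exact mul_nonneg (hf t) (inner_self_nonneg (𝕜 := ℂ))

/-- Multiplication by an essentially bounded function, as a bounded operator on `L²`. -/
noncomputable def mulCLM {g : α → ℂ} (hg : MemLp g ∞ μ) : Lp E 2 μ →L[ℂ] Lp E 2 μ :=
  (ContinuousLinearMap.lsmul ℂ ℂ).holderL μ ∞ 2 2 (hg.toLp g)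

theorem coeFn_mulCLM {g : α → ℂ} (hg : MemLp g ∞ μ) (ψ : Lp E 2 μ) :
    mulCLM hg ψ =ᵐ[μ] fun x => g x • ψ x := by
  filter_upwards [(ContinuousLinearMap.lsmul ℂ ℂ (E := E)).coeFn_holder (r := 2) (hg.toLp g) ψ,
    hg.coeFn_toLp] with x h1 h2
  exact h1.trans (by rw [h2, ContinuousLinearMap.lsmul_apply])

theorem mulOp_eq_toPMap_top {g : α → ℂ} (hg : MemLp g ∞ μ) :
    mulOp g = ((mulCLM hg : Lp E 2 μ →L[ℂ] Lp E 2 μ) : Lp E 2 μ →ₗ[ℂ] Lp E 2 μ).toPMap ⊤ := by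
  refine LinearPMap.eq_of_eq_graph (Submodule.ext fun ⟨x, y⟩ => ?_)
  rw [mem_graph_mulOp_iff, mem_graph_toPMap_top_iff, eq_comm (b := y), ContinuousLinearMap.coe_coe,
    Lp.ext_iff]
  exact ⟨fun h => h.trans (coeFn_mulCLM hg x).symm, fun h => h.trans (coeFn_mulCLM hg x)⟩

theorem mulCLM_mem_graph_mulOp {g : α → ℂ} (hg : MemLp g ∞ μ) (x : Lp E 2 μ) :
    (x, mulCLM hg x) ∈ (mulOp g).graph :=
  mem_graph_mulOp_iff.2 (coeFn_mulCLM hg x)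

theorem commutesWith_mulOp_iff {A : Lp E 2 μ →L[ℂ] Lp E 2 μ} {g : α → ℂ} (hg : MemLp g ∞ μ) :
    CommutesWith A (mulOp g) ↔ Commute A (mulCLM hg) := by
  rw [mulOp_eq_toPMap_top hg, commutesWith_toPMap_top_iff]

variable [CompleteSpace E]

theorem isSelfAdjoint_mulCLM {f : α → ℝ} (hf : MemLp (fun x => (f x : ℂ)) ∞ μ) :
    IsSelfAdjoint (mulCLM hf : Lp E 2 μ →L[ℂ] Lp E 2 μ) :=
  ContinuousLinearMap.isSelfAdjoint_iff_isSymmetric.2 fun x y =>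
    inner_eq_inner_of_mem_graph_mulOp (mulCLM_mem_graph_mulOp hf x) (mulCLM_mem_graph_mulOp hf y)

end MultiplicationOperator

section RealMultiplication

variable {α : Type*} [MeasurableSpace α] {μ : Measure α} {E : Type*} [NormedAddCommGroup E]
  [InnerProductSpace ℂ E] {f : α → ℝ}

theorem memLp_inv_japaneseBracket (hf : AEStronglyMeasurable f μ) :
    MemLp (fun t => (((japaneseBracket (f t))⁻¹ : ℝ) : ℂ)) ∞ μ := by
  have hcont : Continuous fun t => (japaneseBracket t)⁻¹ :=
    continuous_japaneseBracket.inv₀ fun t => (japaneseBracket_pos t).ne'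
  refine memLp_top_of_bound (Complex.continuous_ofReal.comp_aestronglyMeasurable
    (hcont.comp_aestronglyMeasurable hf)) 1 (ae_of_all _ fun t => ?_)
  rw [Complex.norm_real]
  exact norm_inv_japaneseBracket_le_one (f t)

theorem memLp_mul_inv_japaneseBracket (hf : AEStronglyMeasurable f μ) :
    MemLp (fun t => ((f t * (japaneseBracket (f t))⁻¹ : ℝ) : ℂ)) ∞ μ := by
  have hcont : Continuous fun t => t * (japaneseBracket t)⁻¹ :=
    continuous_id.mul (continuous_japaneseBracket.inv₀ fun t => (japaneseBracket_pos t).ne')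
  refine memLp_top_of_bound (Complex.continuous_ofReal.comp_aestronglyMeasurable
    (hcont.comp_aestronglyMeasurable hf)) 1 (ae_of_all _ fun t => ?_)
  rw [Complex.norm_real]
  exact norm_mul_inv_japaneseBracket_le_one (f t)

theorem mulCLM_inv_japaneseBracket_mem_graph (hf : AEStronglyMeasurable f μ) (χ : Lp E 2 μ) :
    (mulCLM (memLp_inv_japaneseBracket hf) χ, mulCLM (memLp_mul_inv_japaneseBracket hf) χ) ∈
      (mulOp fun t => (f t : ℂ)).graph := by
  rw [mem_graph_mulOp_iff]
  filter_upwards [coeFn_mulCLM (memLp_inv_japaneseBracket hf) χ,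
    coeFn_mulCLM (memLp_mul_inv_japaneseBracket hf) χ] with t h1 h2
  rw [h1, h2, smul_smul, Complex.ofReal_mul]

theorem mem_graph_mulOp_iff_mulCLM_eq (hf : AEStronglyMeasurable f μ) {x y : Lp E 2 μ} :
    (x, y) ∈ (mulOp fun t => (f t : ℂ)).graph ↔
      mulCLM (memLp_inv_japaneseBracket hf) y = mulCLM (memLp_mul_inv_japaneseBracket hf) x := by
  rw [mem_graph_mulOp_iff, Lp.ext_iff]
  refine eventually_congr ?_
  filter_upwards [coeFn_mulCLM (memLp_inv_japaneseBracket hf) y,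
    coeFn_mulCLM (memLp_mul_inv_japaneseBracket hf) x] with t h1 h2
  have hne : (((japaneseBracket (f t))⁻¹ : ℝ) : ℂ) ≠ 0 :=
    Complex.ofReal_ne_zero.2 (inv_ne_zero (japaneseBracket_pos _).ne')
  rw [h1, h2, mul_comm, Complex.ofReal_mul, mul_smul, (smul_right_injective E hne).eq_iff]

theorem exists_mulCLM_eq_of_mem_graph_mulOp (hf : AEStronglyMeasurable f μ) {x y : Lp E 2 μ}
    (h : (x, y) ∈ (mulOp fun t => (f t : ℂ)).graph) :
    ∃ χ : Lp E 2 μ, mulCLM (memLp_inv_japaneseBracket hf) χ = x ∧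
      mulCLM (memLp_mul_inv_japaneseBracket hf) χ = y := by
  set B : Lp E 2 μ →L[ℂ] Lp E 2 μ := mulCLM (memLp_inv_japaneseBracket hf)
  set C : Lp E 2 μ →L[ℂ] Lp E 2 μ := mulCLM (memLp_mul_inv_japaneseBracket hf)
  -- `1 / ⟨f⟩ ^ 2 + f ^ 2 / ⟨f⟩ ^ 2 = 1`, where `⟨f⟩` is the Japanese bracket of `f`.
  have hx : B (B x + C y) = x := by
    refine Lp.ext ?_
    filter_upwards [mem_graph_mulOp_iff.1 h, coeFn_mulCLM (memLp_inv_japaneseBracket hf) x,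
      coeFn_mulCLM (memLp_mul_inv_japaneseBracket hf) y, Lp.coeFn_add (B x) (C y),
      coeFn_mulCLM (memLp_inv_japaneseBracket hf) (B x + C y)] with t h1 h2 h3 h4 h5
    have hsq := japaneseBracket_sq (f t)
    have hne := (japaneseBracket_pos (f t)).ne'
    rw [h5, h4, Pi.add_apply, h2, h3, h1, smul_smul, ← add_smul, smul_smul]
    refine (congrArg (· • x t) ?_).trans (one_smul ℂ (x t))
    norm_cast
    field_simp
    linarith
  refine ⟨B x + C y, hx, LinearPMap.mem_graph_snd_inj _
    (mulCLM_inv_japaneseBracket_mem_graph hf _) h hx⟩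

variable [CompleteSpace E]

theorem dense_domain_mulOp (hf : AEStronglyMeasurable f μ) :
    Dense ((mulOp (μ := μ) (E := E) fun t => (f t : ℂ)).domain : Set (Lp E 2 μ)) := by
  set B : Lp E 2 μ →L[ℂ] Lp E 2 μ := mulCLM (memLp_inv_japaneseBracket hf)
  have hinj : B.ker = ⊥ := by
    refine (Submodule.eq_bot_iff _).2 fun x hx => ?_
    have hzero : (0, x) ∈ (mulOp fun t => (f t : ℂ)).graph := by
      rw [mem_graph_mulOp_iff_mulCLM_eq hf, map_zero]
      exact hx
    exact LinearPMap.graph_fst_eq_zero_snd _ hzero rfl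
  have hrange : B.range.topologicalClosure = ⊤ := by
    rw [Submodule.topologicalClosure_eq_top_iff, ContinuousLinearMap.orthogonal_range,
      (isSelfAdjoint_mulCLM (memLp_inv_japaneseBracket hf)).adjoint_eq, hinj]
  refine (Submodule.dense_iff_topologicalClosure_eq_top.2 hrange).mono ?_
  rintro _ ⟨χ, rfl⟩
  exact LinearPMap.mem_domain_of_mem_graph (mulCLM_inv_japaneseBracket_mem_graph hf χ)

theorem isSelfAdjoint_mulOp (hf : AEStronglyMeasurable f μ) :
    IsSelfAdjoint (mulOp (μ := μ) (E := E) fun t => (f t : ℂ)) := by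
  have hdense := dense_domain_mulOp (E := E) hf
  set X := mulOp (μ := μ) (E := E) fun t => (f t : ℂ)
  have hsymm : X.IsFormalAdjoint X := fun x y =>
    inner_eq_inner_of_mem_graph_mulOp (f := f) (X.mem_graph x) (X.mem_graph y)
  refine LinearPMap.isSelfAdjoint_def.2 (le_antisymm ?_ (hsymm.le_adjoint hdense))
  refine LinearPMap.le_graph_iff.1 fun ⟨u, v⟩ huv => ?_
  obtain ⟨hu, rfl⟩ := mem_graph_iff_exists_mem_domain.1 huv
  rw [mem_graph_mulOp_iff_mulCLM_eq hf]
  refine ext_inner_right ℂ fun χ => ?_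
  obtain ⟨hx, hx'⟩ := mem_graph_iff_exists_mem_domain.1
    (mulCLM_inv_japaneseBracket_mem_graph hf χ)
  have hadj := X.adjoint_isFormalAdjoint hdense ⟨u, hu⟩ ⟨_, hx⟩
  rw [hx'] at hadj
  rwa [← ContinuousLinearMap.adjoint_inner_right, ← ContinuousLinearMap.adjoint_inner_right,
    (isSelfAdjoint_mulCLM _).adjoint_eq, (isSelfAdjoint_mulCLM _).adjoint_eq]

theorem isSqrtOneAddSq_mulOp (hf : AEStronglyMeasurable f μ) :
    IsSqrtOneAddSq (mulOp (μ := μ) (E := E) fun t => (f t : ℂ))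
      (mulOp fun t => (japaneseBracket (f t) : ℂ)) := by
  have hbracket := continuous_japaneseBracket.comp_aestronglyMeasurable hf
  refine ⟨isSelfAdjoint_mulOp hbracket, re_inner_mulOp_nonneg fun t => (japaneseBracket_pos _).le,
    ?_⟩
  rw [opMul_mulOp_self (Complex.continuous_ofReal.comp_aestronglyMeasurable hbracket),
    opMul_mulOp_self (Complex.continuous_ofReal.comp_aestronglyMeasurable hf), id_vadd_mulOp]
  congr 1
  funext t
  simp only [Pi.pow_apply, Pi.add_apply, Pi.one_apply]
  exact mod_cast japaneseBracket_sq (f t)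

end RealMultiplication

/-! ## Functions of a real observable -/

section FunctionsOfObservable

variable {α : Type*} [MeasurableSpace α] {μ : Measure α} {E : Type*} [NormedAddCommGroup E]
  [InnerProductSpace ℂ E] {A : Lp E 2 μ →L[ℂ] Lp E 2 μ} {ℓ : α → ℝ}

theorem memLp_cexp_mul_I (hℓ : Measurable ℓ) (k : ℝ) :
    MemLp (fun x => Complex.exp ((k * ℓ x : ℝ) * Complex.I)) ∞ μ :=
  memLp_top_of_bound (by fun_prop) 1 (ae_of_all _ fun _ => (Complex.norm_exp_ofReal_mul_I _).le)

theorem memLp_schwartz_comp (hℓ : Measurable ℓ) (g : 𝓢(ℝ, ℂ)) : MemLp (fun x => g (ℓ x)) ∞ μ :=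
  memLp_top_of_bound (g.continuous.measurable.comp hℓ).aestronglyMeasurable
    ‖g.toBoundedContinuousFunction‖
    (ae_of_all _ fun x => g.toBoundedContinuousFunction.norm_coe_le_norm (ℓ x))

theorem schwartz_eq_integral_cexp_mul_fourier (g : 𝓢(ℝ, ℂ)) (t : ℝ) :
    g t = ∫ k : ℝ, Complex.exp ((2 * Real.pi * k * t : ℝ) * Complex.I) * (𝓕 g) k := by
  have hinv : 𝓕⁻ (𝓕 g) t = g t := by rw [FourierTransform.fourierInv_fourier_eq]
  rw [← hinv, SchwartzMap.fourierInv_coe, Real.fourierInv_eq']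
  refine integral_congr_ae (Eventually.of_forall fun k => ?_)
  simp only [smul_eq_mul, RCLike.inner_apply, conj_trivial]
  congr 4
  ring

theorem commutesWith_mulOp_of_cutoff {b : ℕ → α → ℂ} {g : α → ℂ} (hb : ∀ m, MemLp (b m) ∞ μ)
    (hne : ∀ x, ∃ m, b m x ≠ 0) (hAb : ∀ m, CommutesWith A (mulOp (b m)))
    (hAbg : ∀ m, CommutesWith A (mulOp fun x => b m x * g x)) : CommutesWith A (mulOp g) := by
  refine commutesWith_iff_graph.2 fun x y hxy => mem_graph_mulOp_iff.2 ?_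
  have hcutoff : ∀ m, (x, mulCLM (hb m) y) ∈ (mulOp fun t => b m t * g t).graph := by
    intro m
    rw [mem_graph_mulOp_iff] at hxy ⊢
    filter_upwards [hxy, coeFn_mulCLM (hb m) y] with t h1 h2
    rw [h2, h1, smul_smul]
  have hae : ∀ᵐ t ∂μ, ∀ m, b m t • A y t = b m t • g t • A x t := by
    refine ae_all_iff.2 fun m => ?_
    have h1 := commutesWith_iff_graph.1 (hAb m) _ _ (mulCLM_mem_graph_mulOp (hb m) y)
    have h2 := commutesWith_iff_graph.1 (hAbg m) _ _ (hcutoff m)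
    filter_upwards [mem_graph_mulOp_iff.1 h1, mem_graph_mulOp_iff.1 h2] with t h1 h2
    rw [← h1, h2, mul_smul]
  filter_upwards [hae] with t ht
  obtain ⟨m, hm⟩ := hne t
  exact smul_right_injective E hm (ht m)

theorem integrable_cexp_mul_fourier_mul_inner (hℓ : Measurable ℓ) (g : 𝓢(ℝ, ℂ))
    (φ ψ : Lp E 2 μ) :
    Integrable (fun p : α × ℝ => Complex.exp ((2 * Real.pi * p.2 * ℓ p.1 : ℝ) * Complex.I) *
      ((𝓕 g) p.2 * inner ℂ (φ p.1) (ψ p.1))) (μ.prod volume) := by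
  have hprod := (L2.integrable_inner (𝕜 := ℂ) φ ψ).mul_prod ((𝓕 g).integrable (μ := volume))
  simp only [mul_comm (inner ℂ (φ _) (ψ _))] at hprod
  exact hprod.bdd_mul (c := 1) (Measurable.aestronglyMeasurable (by fun_prop))
    (Eventually.of_forall fun p => (Complex.norm_exp_ofReal_mul_I _).le)

variable [SFinite μ]

theorem inner_mulCLM_schwartz_comp (hℓ : Measurable ℓ) (g : 𝓢(ℝ, ℂ)) (φ ψ : Lp E 2 μ) :
    inner ℂ φ (mulCLM (memLp_schwartz_comp hℓ g) ψ) =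
      ∫ k : ℝ, (𝓕 g) k * inner ℂ φ (mulCLM (memLp_cexp_mul_I hℓ (2 * Real.pi * k)) ψ) := by
  calc inner ℂ φ (mulCLM (memLp_schwartz_comp hℓ g) ψ)
      = ∫ x, (∫ k : ℝ, Complex.exp ((2 * Real.pi * k * ℓ x : ℝ) * Complex.I) *
          ((𝓕 g) k * inner ℂ (φ x) (ψ x))) ∂μ := by
        rw [L2.inner_def]
        refine integral_congr_ae ?_
        filter_upwards [coeFn_mulCLM (memLp_schwartz_comp hℓ g) ψ] with x hx
        simp only [hx, inner_smul_right, ← mul_assoc, integral_mul_const]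
        rw [← schwartz_eq_integral_cexp_mul_fourier]
    _ = ∫ k : ℝ, ∫ x, Complex.exp ((2 * Real.pi * k * ℓ x : ℝ) * Complex.I) *
          ((𝓕 g) k * inner ℂ (φ x) (ψ x)) ∂μ :=
        integral_integral_swap (integrable_cexp_mul_fourier_mul_inner hℓ g φ ψ)
    _ = _ := by
        refine integral_congr_ae (Eventually.of_forall fun k => ?_)
        simp only [L2.inner_def, ← integral_const_mul]
        refine integral_congr_ae ?_
        filter_upwards [coeFn_mulCLM (memLp_cexp_mul_I hℓ (2 * Real.pi * k)) ψ] with x hx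
        rw [hx, inner_smul_right]
        ring

theorem commutesWith_mulOp_schwartz_comp [CompleteSpace E] (hℓ : Measurable ℓ)
    (hA : ∀ k : ℝ, CommutesWith A (mulOp fun x => Complex.exp ((k * ℓ x : ℝ) * Complex.I)))
    (g : 𝓢(ℝ, ℂ)) : CommutesWith A (mulOp fun x => g (ℓ x)) := by
  have hwave : ∀ k ψ, A (mulCLM (memLp_cexp_mul_I hℓ k) ψ) =
      mulCLM (memLp_cexp_mul_I hℓ k) (A ψ) := fun k ψ =>
    DFunLike.congr_fun ((commutesWith_mulOp_iff (memLp_cexp_mul_I hℓ k)).1 (hA k)).eq ψ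
  refine (commutesWith_mulOp_iff (memLp_schwartz_comp hℓ g)).2
    (ContinuousLinearMap.ext fun ψ => ext_inner_left ℂ fun φ => ?_)
  rw [mul_apply_eq_comp, mul_apply_eq_comp, ← ContinuousLinearMap.adjoint_inner_left,
    inner_mulCLM_schwartz_comp hℓ, inner_mulCLM_schwartz_comp hℓ]
  simp only [ContinuousLinearMap.adjoint_inner_left, hwave]

theorem commutesWith_mulOp_comp [CompleteSpace E] (hℓ : Measurable ℓ)
    (hA : ∀ k : ℝ, CommutesWith A (mulOp fun x => Complex.exp ((k * ℓ x : ℝ) * Complex.I)))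
    {g : ℝ → ℂ} (hg : ContDiff ℝ ∞ g) : CommutesWith A (mulOp fun x => g (ℓ x)) := by
  let b : ℕ → ContDiffBump (0 : ℝ) := fun m => ⟨m + 1, m + 2, by positivity, by linarith⟩
  have hsupp : ∀ m, HasCompactSupport fun t => (b m t : ℂ) := fun m =>
    (b m).hasCompactSupport.comp_left Complex.ofReal_zero
  have hsmooth : ∀ m, ContDiff ℝ ∞ fun t => (b m t : ℂ) := fun m =>
    Complex.ofRealCLM.contDiff.comp (b m).contDiff
  have hone : ∀ t : ℝ, ∃ m, (b m t : ℂ) ≠ 0 := by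
    intro t
    obtain ⟨m, hm⟩ := exists_nat_ge |t|
    have hmem : t ∈ Metric.closedBall (0 : ℝ) (m + 1) := by
      rw [Metric.mem_closedBall, dist_zero_right, Real.norm_eq_abs]
      linarith
    exact ⟨m, by rw [(b m).one_of_mem_closedBall hmem, Complex.ofReal_one]; exact one_ne_zero⟩
  exact commutesWith_mulOp_of_cutoff
    (fun m => memLp_schwartz_comp hℓ ((hsupp m).toSchwartzMap (hsmooth m)))
    (fun x => hone (ℓ x))
    (fun m => commutesWith_mulOp_schwartz_comp hℓ hA ((hsupp m).toSchwartzMap (hsmooth m)))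
    (fun m => commutesWith_mulOp_schwartz_comp hℓ hA
      (((hsupp m).mul_right (f' := g)).toSchwartzMap ((hsmooth m).mul hg)))

end FunctionsOfObservable

/-! ## Operators on Schwartz functions -/

section LineDerivatives

variable {V F : Type*} [NormedAddCommGroup V] [NormedSpace ℝ V] [NormedAddCommGroup F]
  [NormedSpace ℂ F]

theorem hasTemperateGrowth_ofReal_comp {f : V → ℝ} (hf : f.HasTemperateGrowth) :
    (fun x => (f x : ℂ)).HasTemperateGrowth :=
  Complex.ofRealCLM.hasTemperateGrowth.comp hf

theorem lineDeriv_postcomp {G : Type*} [NormedAddCommGroup G] [NormedSpace ℂ G]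
    (T : F →L[ℂ] G) (v : V) (ψ : 𝓢(V, F)) :
    ∂_{v} (ψ.postcompCLM T) = (∂_{v} ψ).postcompCLM T := by
  ext1 x
  have h := ((T.restrictScalars ℝ).hasFDerivAt.comp x (ψ.hasFDerivAt x)).fderiv
  rw [SchwartzMap.postcompCLM_apply, SchwartzMap.lineDerivOp_apply_eq_fderiv,
    SchwartzMap.lineDerivOp_apply_eq_fderiv]
  exact congrArg (fun S => S v) h

theorem lineDeriv_smulLeft {g : V → ℂ} (hg : g.HasTemperateGrowth) (v : V) (ψ : 𝓢(V, F)) (x : V) :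
    (∂_{v} (SchwartzMap.smulLeftCLM F g ψ)) x = g x • (∂_{v} ψ) x + fderiv ℝ g x v • ψ x := by
  have hg' : DifferentiableAt ℝ g x := hg.1.differentiable (by simp) x
  have h := (hg'.hasFDerivAt.smul (ψ.hasFDerivAt x)).fderiv
  have hψ : ⇑(SchwartzMap.smulLeftCLM F g ψ) = g • ⇑ψ :=
    funext fun y => SchwartzMap.smulLeftCLM_apply_apply hg ψ y
  rw [SchwartzMap.lineDerivOp_apply_eq_fderiv, SchwartzMap.lineDerivOp_apply_eq_fderiv, hψ, h]
  rfl

end LineDerivatives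

section SchwartzOperators

variable {V F : Type*} [NormedAddCommGroup V] [InnerProductSpace ℝ V] [FiniteDimensional ℝ V]
  [MeasurableSpace V] [BorelSpace V] [NormedAddCommGroup F] [InnerProductSpace ℂ F]

/-- The inclusion of the Schwartz functions in `L²`. -/
noncomputable abbrev toL2 : 𝓢(V, F) →L[ℂ] Lp F 2 (volume : Measure V) :=
  SchwartzMap.toLpCLM ℂ F 2 volume

theorem coeFn_toL2 (ψ : 𝓢(V, F)) : toL2 ψ =ᵐ[volume] ψ := ψ.coeFn_toLp 2 volume

theorem inner_toL2 (φ ψ : 𝓢(V, F)) : inner ℂ (toL2 φ) (toL2 ψ) = ∫ x, inner ℂ (φ x) (ψ x) :=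
  SchwartzMap.inner_toL2_toL2_eq φ ψ volume

theorem denseRange_toL2 : DenseRange (toL2 : 𝓢(V, F) → Lp F 2 (volume : Measure V)) :=
  SchwartzMap.denseRange_toLpCLM (by simp)

theorem toL2_mem_graph_mulOp {g : V → ℂ} (hg : g.HasTemperateGrowth) (ψ : 𝓢(V, F)) :
    (toL2 ψ, toL2 (SchwartzMap.smulLeftCLM F g ψ)) ∈ (mulOp g).graph := by
  rw [mem_graph_mulOp_iff]
  filter_upwards [coeFn_toL2 ψ, coeFn_toL2 (SchwartzMap.smulLeftCLM F g ψ)] with x h1 h2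
  rw [h1, h2, SchwartzMap.smulLeftCLM_apply_apply hg]

theorem mulCLM_toL2 {g : V → ℂ} (hg : MemLp g ∞ volume) (hg' : g.HasTemperateGrowth)
    (ψ : 𝓢(V, F)) : mulCLM hg (toL2 ψ) = toL2 (SchwartzMap.smulLeftCLM F g ψ) :=
  LinearPMap.mem_graph_snd_inj _ (mulCLM_mem_graph_mulOp hg _) (toL2_mem_graph_mulOp hg' ψ) rfl

/-- `L'` is a formal adjoint of `L`, with respect to the inner product of `L²`. -/
def IsSchwartzAdjoint (L L' : 𝓢(V, F) →L[ℂ] 𝓢(V, F)) : Prop :=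
  ∀ φ ψ, inner ℂ (toL2 φ) (toL2 (L ψ)) = inner ℂ (toL2 (L' φ)) (toL2 ψ)

namespace IsSchwartzAdjoint

variable {L L' M M' : 𝓢(V, F) →L[ℂ] 𝓢(V, F)}

theorem comp (hL : IsSchwartzAdjoint L L') (hM : IsSchwartzAdjoint M M') :
    IsSchwartzAdjoint (L ∘L M) (M' ∘L L') :=
  fun φ ψ => (hL φ (M ψ)).trans (hM (L' φ) ψ)

theorem add (hL : IsSchwartzAdjoint L L') (hM : IsSchwartzAdjoint M M') :
    IsSchwartzAdjoint (L + M) (L' + M') := fun φ ψ => by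
  simp only [add_apply, map_add, inner_add_left, inner_add_right, hL φ ψ, hM φ ψ]

theorem smul (c : ℂ) (hL : IsSchwartzAdjoint L L') : IsSchwartzAdjoint (c • L) (star c • L') :=
  fun φ ψ => by
    simp only [smul_apply, map_smul, inner_smul_left, inner_smul_right, hL φ ψ,
      starRingEnd_apply, star_star]

theorem sum {ι : Type*} (s : Finset ι) {L L' : ι → 𝓢(V, F) →L[ℂ] 𝓢(V, F)}
    (h : ∀ i, IsSchwartzAdjoint (L i) (L' i)) :
    IsSchwartzAdjoint (∑ i ∈ s, L i) (∑ i ∈ s, L' i) := fun φ ψ => by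
  simp only [sum_apply, map_sum, inner_sum, sum_inner, h _ φ ψ]

end IsSchwartzAdjoint

theorem isSchwartzAdjoint_lineDeriv (v : V) :
    IsSchwartzAdjoint (LineDeriv.lineDerivOpCLM ℂ 𝓢(V, F) v)
      (-LineDeriv.lineDerivOpCLM ℂ 𝓢(V, F) v) := fun φ ψ => by
  rw [neg_apply, map_neg, inner_neg_left, inner_toL2, inner_toL2]
  exact SchwartzMap.integral_bilinear_lineDerivOp_right_eq_neg_left φ ψ
    (isBoundedBilinearMap_inner (𝕜 := ℂ) (E := F)).toContinuousLinearMap v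

theorem isSchwartzAdjoint_smulLeft {f : V → ℝ} (hf : f.HasTemperateGrowth) :
    IsSchwartzAdjoint (SchwartzMap.smulLeftCLM F fun x => (f x : ℂ))
      (SchwartzMap.smulLeftCLM F fun x => (f x : ℂ)) := fun φ ψ =>
  have hf' := hasTemperateGrowth_ofReal_comp hf
  (inner_eq_inner_of_mem_graph_mulOp (toL2_mem_graph_mulOp hf' φ)
    (toL2_mem_graph_mulOp hf' ψ)).symm

theorem isSchwartzAdjoint_postcomp [CompleteSpace F] (T : F →L[ℂ] F) :
    IsSchwartzAdjoint (V := V) (SchwartzMap.postcompCLM T)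
      (SchwartzMap.postcompCLM (ContinuousLinearMap.adjoint T)) := fun φ ψ => by
  simp only [inner_toL2, SchwartzMap.postcompCLM_apply, ContinuousLinearMap.adjoint_inner_left]

end SchwartzOperators

/-! ## Closures of operators on Schwartz spinors -/

section Closures

variable {n : ℕ} {L L' : SpinorSchwartz n →L[ℂ] SpinorSchwartz n}

theorem closureOfSchwartzOp_eq_toLinearPMap (L : SpinorSchwartz n →L[ℂ] SpinorSchwartz n) :
    closureOfSchwartzOp (fun ψ => L ψ) =
      (toL2.prod (toL2 ∘L L)).range.topologicalClosure.toLinearPMap := by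
  have hset : {p : SpinorL2 n × SpinorL2 n | ∃ ψ : SpinorSchwartz n, p.1 = ψ.toLp 2 volume ∧
      (p.2 : MinkowskiSpace n → SpinorFibre n) =ᵐ[volume] L ψ} =
      ((toL2.prod (toL2 ∘L L)).range : Set (SpinorL2 n × SpinorL2 n)) := by
    ext ⟨x, y⟩
    constructor
    · rintro ⟨ψ, rfl, hy⟩
      exact ⟨ψ, Prod.ext rfl (Lp.ext ((coeFn_toL2 (L ψ)).trans hy.symm))⟩
    · rintro ⟨ψ, h⟩
      obtain ⟨rfl, rfl⟩ := Prod.ext_iff.1 h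
      exact ⟨ψ, rfl, coeFn_toL2 (L ψ)⟩
  rw [closureOfSchwartzOp, hset, Submodule.span_eq]

theorem inner_eq_of_mem_topologicalClosure (h : IsSchwartzAdjoint L L')
    {p : SpinorL2 n × SpinorL2 n}
    (hp : p ∈ (toL2.prod (toL2 ∘L L)).range.topologicalClosure) (φ : SpinorSchwartz n) :
    inner ℂ (toL2 φ) p.2 = inner ℂ (toL2 (L' φ)) p.1 := by
  have hclosed : IsClosed {p : SpinorL2 n × SpinorL2 n |
      inner ℂ (toL2 φ) p.2 = inner ℂ (toL2 (L' φ)) p.1} :=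
    isClosed_eq (by fun_prop) (by fun_prop)
  refine closure_minimal ?_ hclosed hp
  rintro _ ⟨ψ, rfl⟩
  exact h φ ψ

theorem graph_closureOfSchwartzOp (h : IsSchwartzAdjoint L L') :
    (closureOfSchwartzOp fun ψ => L ψ).graph =
      (toL2.prod (toL2 ∘L L)).range.topologicalClosure := by
  rw [closureOfSchwartzOp_eq_toLinearPMap]
  refine Submodule.toLinearPMap_graph_eq _ fun p hp h0 =>
    denseRange_toL2.eq_of_inner_right ℂ fun φ => ?_
  rw [inner_eq_of_mem_topologicalClosure h hp φ, h0, inner_zero_right, inner_zero_right]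

theorem inner_eq_of_mem_graph_closureOfSchwartzOp (h : IsSchwartzAdjoint L L') {x y : SpinorL2 n}
    (hp : (x, y) ∈ (closureOfSchwartzOp fun ψ => L ψ).graph) (φ : SpinorSchwartz n) :
    inner ℂ (toL2 φ) y = inner ℂ (toL2 (L' φ)) x :=
  inner_eq_of_mem_topologicalClosure h (graph_closureOfSchwartzOp h ▸ hp) φ

theorem toL2_mem_graph_closureOfSchwartzOp (h : IsSchwartzAdjoint L L') (ψ : SpinorSchwartz n) :
    (toL2 ψ, toL2 (L ψ)) ∈ (closureOfSchwartzOp fun ψ => L ψ).graph := by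
  rw [graph_closureOfSchwartzOp h]
  exact Submodule.le_topologicalClosure _ ⟨ψ, rfl⟩

end Closures

section MultiplicationClosure

theorem hasTemperateGrowth_japaneseBracket : japaneseBracket.HasTemperateGrowth := by
  have h : japaneseBracket = fun t : ℝ => (1 + ‖t‖ ^ 2) ^ (1 / 2 : ℝ) := funext fun t => by
    rw [japaneseBracket, Real.sqrt_eq_rpow, Real.norm_eq_abs, sq_abs]
  exact h ▸ Function.hasTemperateGrowth_one_add_norm_sq_rpow ℝ (1 / 2)

theorem hasTemperateGrowth_inv_japaneseBracket :
    (fun t => (japaneseBracket t)⁻¹).HasTemperateGrowth := by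
  have h : (fun t => (japaneseBracket t)⁻¹) = fun t : ℝ => (1 + ‖t‖ ^ 2) ^ (-(1 / 2) : ℝ) :=
    funext fun t => by
      rw [japaneseBracket, Real.sqrt_eq_rpow, Real.norm_eq_abs, sq_abs,
        Real.rpow_neg (by positivity)]
  exact h ▸ Function.hasTemperateGrowth_one_add_norm_sq_rpow ℝ (-(1 / 2))

variable {n : ℕ} {f : MinkowskiSpace n → ℝ}

theorem toL2_mem_graph_closureOfSchwartzOp_smulLeft (hf : f.HasTemperateGrowth)
    (hf' : AEStronglyMeasurable f volume) (χ : SpinorL2 n) :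
    (mulCLM (memLp_inv_japaneseBracket hf') χ, mulCLM (memLp_mul_inv_japaneseBracket hf') χ) ∈
      (closureOfSchwartzOp fun ψ : SpinorSchwartz n =>
        SchwartzMap.smulLeftCLM (SpinorFibre n) (fun x => (f x : ℂ)) ψ).graph := by
  have hadj := isSchwartzAdjoint_smulLeft (F := SpinorFibre n) hf
  have hinv := hasTemperateGrowth_ofReal_comp (hasTemperateGrowth_inv_japaneseBracket.comp hf)
  have hquot := hasTemperateGrowth_ofReal_comp
    (hf.mul (hasTemperateGrowth_inv_japaneseBracket.comp hf))
  refine isClosed_property (p := fun χ =>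
    (mulCLM (memLp_inv_japaneseBracket hf') χ, mulCLM (memLp_mul_inv_japaneseBracket hf') χ) ∈
      (closureOfSchwartzOp fun ψ : SpinorSchwartz n =>
        SchwartzMap.smulLeftCLM (SpinorFibre n) (fun x => (f x : ℂ)) ψ).graph)
    denseRange_toL2 ?_ (fun ψ => ?_) χ
  · rw [graph_closureOfSchwartzOp hadj]
    exact (Submodule.isClosed_topologicalClosure _).preimage
      (ContinuousLinearMap.continuous (ContinuousLinearMap.prod _ _))
  · rw [mulCLM_toL2 _ hinv, mulCLM_toL2 _ hquot]
    convert toL2_mem_graph_closureOfSchwartzOp hadj _ using 3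
    rw [SchwartzMap.smulLeftCLM_smulLeftCLM_apply (hasTemperateGrowth_ofReal_comp hf) hinv]
    congr 2
    funext x
    exact Complex.ofReal_mul _ _

theorem closureOfSchwartzOp_smulLeft_eq_mulOp (hf : f.HasTemperateGrowth) :
    (closureOfSchwartzOp fun ψ : SpinorSchwartz n =>
      SchwartzMap.smulLeftCLM (SpinorFibre n) (fun x => (f x : ℂ)) ψ) =
      mulOp fun x => (f x : ℂ) := by
  have hf' : AEStronglyMeasurable f volume := hf.1.continuous.aestronglyMeasurable
  refine LinearPMap.eq_of_eq_graph (le_antisymm ?_ fun ⟨x, y⟩ hxy => ?_)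
  · rw [graph_closureOfSchwartzOp (isSchwartzAdjoint_smulLeft hf)]
    refine Submodule.topologicalClosure_minimal _ ?_ (isSelfAdjoint_mulOp hf').isClosed
    rintro _ ⟨ψ, rfl⟩
    exact toL2_mem_graph_mulOp (hasTemperateGrowth_ofReal_comp hf) ψ
  · obtain ⟨χ, rfl, rfl⟩ := exists_mulCLM_eq_of_mem_graph_mulOp hf' hxy
    exact toL2_mem_graph_closureOfSchwartzOp_smulLeft hf hf' χ

end MultiplicationClosure

/-! ## Commutators of first-order operators with multiplication operators -/

section FirstOrder

variable {ι V F : Type*} [Fintype ι] [NormedAddCommGroup V] [NormedSpace ℝ V]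
  [NormedAddCommGroup F] [NormedSpace ℂ F]

/-- The first-order operator `-i ∑ T_j ∂_{v j}` with constant coefficients on Schwartz functions;
the Dirac operator is the case of the Dirac matrices and the standard basis. -/
noncomputable def firstOrderOp (v : ι → V) (T : ι → F →L[ℂ] F) : 𝓢(V, F) →L[ℂ] 𝓢(V, F) :=
  -Complex.I • ∑ j, SchwartzMap.postcompCLM (T j) ∘L LineDeriv.lineDerivOpCLM ℂ 𝓢(V, F) (v j)

theorem firstOrderOp_apply (v : ι → V) (T : ι → F →L[ℂ] F) (ψ : 𝓢(V, F)) (x : V) :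
    firstOrderOp v T ψ x = -Complex.I • ∑ j, T j ((∂_{v j} ψ) x) := by
  simp only [firstOrderOp, smul_apply, sum_apply]
  rfl

theorem firstOrderOp_smulLeft_apply {f : V → ℝ} (hf : f.HasTemperateGrowth) (v : ι → V)
    (T : ι → F →L[ℂ] F) (ψ : 𝓢(V, F)) (x : V) :
    firstOrderOp v T (SchwartzMap.smulLeftCLM F (fun x => (f x : ℂ)) ψ) x =
      (f x : ℂ) • firstOrderOp v T ψ x -
        Complex.I • ∑ j, ((fderiv ℝ f x (v j) : ℝ) : ℂ) • T j (ψ x) := by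
  have hderiv (w : V) : fderiv ℝ (fun y => (f y : ℂ)) x w = (fderiv ℝ f x w : ℝ) := by
    have hf' : DifferentiableAt ℝ f x := hf.1.differentiable (by simp) x
    exact congrArg (fun S => S w) (Complex.ofRealCLM.hasFDerivAt.comp x hf'.hasFDerivAt).fderiv
  simp only [firstOrderOp_apply, lineDeriv_smulLeft (hasTemperateGrowth_ofReal_comp hf), hderiv,
    map_add, map_smul, Finset.sum_add_distrib, ← Finset.smul_sum, smul_add, neg_smul, smul_neg,
    smul_comm (f x : ℂ), sub_eq_add_neg]

end FirstOrder

section Symbol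

variable {ι V F : Type*} [Fintype ι] [NormedAddCommGroup V] [InnerProductSpace ℝ V]
  [FiniteDimensional ℝ V] [MeasurableSpace V] [BorelSpace V] [NormedAddCommGroup F]
  [InnerProductSpace ℂ F]

/-- The zeroth-order operator `-i ∑ g_j T_j` on `L²`. For `g_j = ∂_{v j} f` it is the commutator
of `firstOrderOp v T` with multiplication by `f`. -/
noncomputable def symbolCLM {g : ι → V → ℝ} (hg : ∀ j, MemLp (fun x => (g j x : ℂ)) ∞ volume)
    (T : ι → F →L[ℂ] F) : Lp F 2 (volume : Measure V) →L[ℂ] Lp F 2 (volume : Measure V) :=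
  -Complex.I • ∑ j, (T j).compLpL 2 volume ∘L mulCLM (hg j)

theorem coeFn_symbolCLM {g : ι → V → ℝ} (hg : ∀ j, MemLp (fun x => (g j x : ℂ)) ∞ volume)
    (T : ι → F →L[ℂ] F) (ψ : Lp F 2 (volume : Measure V)) :
    symbolCLM hg T ψ =ᵐ[volume] fun x => -Complex.I • ∑ j, (g j x : ℂ) • T j (ψ x) := by
  let S (j : ι) : Lp F 2 (volume : Measure V) := (T j).compLpL 2 volume (mulCLM (hg j) ψ)
  have happly : symbolCLM hg T ψ = -Complex.I • ∑ j, S j := by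
    simp only [symbolCLM, smul_apply, sum_apply, ContinuousLinearMap.comp_apply, S]
  have hfibre := ae_all_iff.2 fun j => (T j).coeFn_compLpL (p := 2) (mulCLM (hg j) ψ)
  have hmul := ae_all_iff.2 fun j => coeFn_mulCLM (hg j) ψ
  filter_upwards [Lp.coeFn_smul (-Complex.I) (∑ j, S j), Lp.coeFn_finsetSum Finset.univ S, hfibre,
    hmul] with x hsmul hsum hfibre hmul
  simp only [happly, hsmul, Pi.smul_apply, hsum, Finset.sum_apply, S, hfibre, hmul, map_smul]

theorem inner_symbolCLM_adjoint_left [CompleteSpace F] {g : ι → V → ℝ}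
    (hg : ∀ j, MemLp (fun x => (g j x : ℂ)) ∞ volume) (T : ι → F →L[ℂ] F)
    (φ ψ : Lp F 2 (volume : Measure V)) :
    inner ℂ (symbolCLM hg (fun j => ContinuousLinearMap.adjoint (T j)) φ) ψ =
      -inner ℂ φ (symbolCLM hg T ψ) := by
  rw [L2.inner_def, L2.inner_def, ← integral_neg]
  refine integral_congr_ae ?_
  filter_upwards [coeFn_symbolCLM hg (fun j => ContinuousLinearMap.adjoint (T j)) φ,
    coeFn_symbolCLM hg T ψ] with x h1 h2
  simp only [h1, h2, inner_smul_left, inner_smul_right, sum_inner, inner_sum,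
    ContinuousLinearMap.adjoint_inner_left, Complex.conj_ofReal, map_neg, Complex.conj_I, neg_neg,
    neg_mul]

theorem isSchwartzAdjoint_firstOrderOp [CompleteSpace F] (v : ι → V) (T : ι → F →L[ℂ] F) :
    IsSchwartzAdjoint (firstOrderOp v T)
      (firstOrderOp v fun j => ContinuousLinearMap.adjoint (T j)) := by
  have h := (IsSchwartzAdjoint.sum Finset.univ fun j => (isSchwartzAdjoint_postcomp (T j)).comp
    (isSchwartzAdjoint_lineDeriv (F := F) (v j))).smul (-Complex.I)
  refine fun φ ψ => (h φ ψ).trans (congrArg (fun χ => inner ℂ (toL2 χ) (toL2 ψ)) ?_)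
  simp only [firstOrderOp, smul_apply, sum_apply, ContinuousLinearMap.comp_apply, neg_apply,
    LineDeriv.lineDerivOpCLM_apply, lineDeriv_postcomp, Finset.sum_neg_distrib, star_neg,
    Complex.star_def, Complex.conj_I, neg_neg, smul_neg, neg_smul]

theorem toL2_firstOrderOp_smulLeft {f : V → ℝ} (hf : f.HasTemperateGrowth) {v : ι → V}
    (hg : ∀ j, MemLp (fun x => ((fderiv ℝ f x (v j) : ℝ) : ℂ)) ∞ volume) (T : ι → F →L[ℂ] F)
    (ψ : 𝓢(V, F)) :
    toL2 (firstOrderOp v T (SchwartzMap.smulLeftCLM F (fun x => (f x : ℂ)) ψ)) =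
      toL2 (SchwartzMap.smulLeftCLM F (fun x => (f x : ℂ)) (firstOrderOp v T ψ)) +
        symbolCLM hg T (toL2 ψ) := by
  refine Lp.ext (((coeFn_toL2 _).trans ?_).trans (Lp.coeFn_add _ _).symm)
  filter_upwards [coeFn_toL2 (SchwartzMap.smulLeftCLM F (fun x => (f x : ℂ)) (firstOrderOp v T ψ)),
    coeFn_symbolCLM hg T (toL2 ψ), coeFn_toL2 ψ] with x h1 h2 h3
  rw [firstOrderOp_smulLeft_apply hf, Pi.add_apply, h1, h2, h3, neg_smul, ← sub_eq_add_neg,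
    SchwartzMap.smulLeftCLM_apply_apply (hasTemperateGrowth_ofReal_comp hf)]

end Symbol

section Commutator

variable {n : ℕ} {ι : Type*} [Fintype ι] {f : MinkowskiSpace n → ℝ} {v : ι → MinkowskiSpace n}

theorem opMul_sub_opMul_le_symbolCLM (hf : f.HasTemperateGrowth)
    (hg : ∀ j, MemLp (fun x => ((fderiv ℝ f x (v j) : ℝ) : ℂ)) ∞ volume)
    (T : ι → SpinorFibre n →L[ℂ] SpinorFibre n) :
    opMul (closureOfSchwartzOp fun ψ : SpinorSchwartz n => firstOrderOp v T ψ)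
        (mulOp fun x => (f x : ℂ)) -
      opMul (mulOp fun x => (f x : ℂ))
        (closureOfSchwartzOp fun ψ : SpinorSchwartz n => firstOrderOp v T ψ) ≤
      LinearMap.toPMap (symbolCLM hg T : SpinorL2 n →ₗ[ℂ] SpinorL2 n) ⊤ := by
  have hD := isSchwartzAdjoint_firstOrderOp v T
  have hf' := hasTemperateGrowth_ofReal_comp hf
  refine LinearPMap.le_of_le_graph ?_
  rintro ⟨x, z⟩ h
  obtain ⟨a, b, ha, hb, rfl⟩ := mem_graph_sub_iff.1 h
  obtain ⟨fx, hfx, ha⟩ := mem_graph_opMul_iff.1 ha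
  obtain ⟨Dx, hDx, hb⟩ := mem_graph_opMul_iff.1 hb
  refine mem_graph_toPMap_top_iff.2 (denseRange_toL2.eq_of_inner_right ℂ fun φ => ?_)
  rw [inner_sub_right, inner_eq_of_mem_graph_closureOfSchwartzOp hD ha φ,
    ← inner_eq_inner_of_mem_graph_mulOp (toL2_mem_graph_mulOp hf' _) hfx,
    ← inner_eq_inner_of_mem_graph_mulOp (toL2_mem_graph_mulOp hf' φ) hb,
    inner_eq_of_mem_graph_closureOfSchwartzOp hD hDx, toL2_firstOrderOp_smulLeft hf hg,
    inner_add_left, inner_symbolCLM_adjoint_left, sub_add_cancel_left, neg_neg]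
  rfl

theorem opCommutator_firstOrderOp_mulOp (hf : f.HasTemperateGrowth)
    (hg : ∀ j, MemLp (fun x => ((fderiv ℝ f x (v j) : ℝ) : ℂ)) ∞ volume)
    (T : ι → SpinorFibre n →L[ℂ] SpinorFibre n) :
    opCommutator (closureOfSchwartzOp fun ψ : SpinorSchwartz n => firstOrderOp v T ψ)
        (mulOp fun x => (f x : ℂ)) =
      LinearMap.toPMap (symbolCLM hg T : SpinorL2 n →ₗ[ℂ] SpinorL2 n) ⊤ := by
  have hD := isSchwartzAdjoint_firstOrderOp v T
  have hf' := hasTemperateGrowth_ofReal_comp hf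
  refine closure_eq_toPMap_top (opMul_sub_opMul_le_symbolCLM hf hg T)
    (denseRange_toL2.mono ?_)
  rintro _ ⟨ψ, rfl⟩
  have hleft := mem_graph_opMul_iff.2 ⟨_, toL2_mem_graph_mulOp hf' ψ,
    toL2_mem_graph_closureOfSchwartzOp hD _⟩
  have hright := mem_graph_opMul_iff.2 ⟨_, toL2_mem_graph_closureOfSchwartzOp hD ψ,
    toL2_mem_graph_mulOp hf' _⟩
  exact LinearPMap.mem_domain_of_mem_graph (mem_graph_sub_iff.2 ⟨_, _, hleft, hright, rfl⟩)

end Commutator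

/-! ## Plane waves and translations -/

section PlaneWave

variable {V : Type*} [NormedAddCommGroup V] [InnerProductSpace ℝ V]

/-- The plane wave `x ↦ e^{i⟨k, x⟩}`. -/
noncomputable def planeWave (k x : V) : ℂ := Complex.exp ((inner ℝ k x : ℝ) * Complex.I)

theorem norm_planeWave (k x : V) : ‖planeWave k x‖ = 1 := Complex.norm_exp_ofReal_mul_I _

theorem planeWave_add (k x y : V) : planeWave k (x + y) = planeWave k x * planeWave k y := by
  simp only [planeWave, inner_add_right, Complex.ofReal_add, add_mul, Complex.exp_add]

theorem contDiff_planeWave (k : V) : ContDiff ℝ ∞ (planeWave k) :=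
  ((Complex.ofRealCLM ∘L innerSL ℝ k).contDiff.mul contDiff_const).cexp

theorem fderiv_planeWave_apply (k x v : V) :
    fderiv ℝ (planeWave k) x v = planeWave k x * ((inner ℝ k v : ℝ) * Complex.I) := by
  have h := ((Complex.ofRealCLM ∘L innerSL ℝ k).hasFDerivAt (x := x)).mul_const Complex.I |>.cexp
  exact (congrArg (fun S => S v) h.fderiv).trans
    (congrArg (planeWave k x * ·) (mul_comm Complex.I _))

theorem hasDerivAt_cexp_ofReal_mul_I (t : ℝ) :
    HasDerivAt (fun t : ℝ => Complex.exp (t * Complex.I))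
      (Complex.I * Complex.exp (t * Complex.I)) t := by
  have h := ((hasDerivAt_id t).ofReal_comp.mul_const Complex.I).cexp
  rwa [Complex.ofReal_one, one_mul, mul_comm] at h

theorem iteratedDeriv_cexp_ofReal_mul_I (m : ℕ) :
    iteratedDeriv m (fun t : ℝ => Complex.exp (t * Complex.I)) =
      fun t : ℝ => Complex.I ^ m * Complex.exp (t * Complex.I) := by
  induction m with
  | zero => simp
  | succ m ih =>
    rw [iteratedDeriv_succ, ih]
    funext t
    rw [((hasDerivAt_cexp_ofReal_mul_I t).const_mul _).deriv, pow_succ, mul_assoc]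

theorem norm_iteratedFDeriv_planeWave_le (k : V) (m : ℕ) (x : V) :
    ‖iteratedFDeriv ℝ m (planeWave k) x‖ ≤ ‖innerSL ℝ k‖ ^ m := by
  have hexp : ContDiff ℝ ∞ fun t : ℝ => Complex.exp (t * Complex.I) :=
    (Complex.ofRealCLM.contDiff.mul contDiff_const).cexp
  have hcomp : planeWave k = (fun t : ℝ => Complex.exp (t * Complex.I)) ∘ innerSL ℝ k := rfl
  rw [hcomp, (innerSL ℝ k).iteratedFDeriv_comp_right hexp x (mod_cast le_top)]
  refine (ContinuousMultilinearMap.norm_compContinuousLinearMap_le _ _).trans_eq ?_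
  rw [norm_iteratedFDeriv_eq_norm_iteratedDeriv, iteratedDeriv_cexp_ofReal_mul_I, norm_mul,
    norm_pow, Complex.norm_I, one_pow, Complex.norm_exp_ofReal_mul_I, one_mul, one_mul,
    Finset.prod_const, Finset.card_univ, Fintype.card_fin]

theorem hasTemperateGrowth_planeWave (k : V) : (planeWave k).HasTemperateGrowth :=
  ⟨contDiff_planeWave k, fun m => ⟨0, ‖innerSL ℝ k‖ ^ m, fun x => by
    rw [pow_zero, mul_one]
    exact norm_iteratedFDeriv_planeWave_le k m x⟩⟩

theorem memLp_planeWave [MeasurableSpace V] [OpensMeasurableSpace V] (k : V)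
    {μ : Measure V} : MemLp (planeWave k) ∞ μ :=
  memLp_top_of_bound (contDiff_planeWave k).continuous.stronglyMeasurable.aestronglyMeasurable 1
    (ae_of_all _ fun x => (norm_planeWave k x).le)

end PlaneWave

section Weyl

variable {V F : Type*} [NormedAddCommGroup V] [NormedAddCommGroup F]

theorem lineDeriv_compSubConst [NormedSpace ℝ V] [NormedSpace ℂ F] (a v : V) (ψ : 𝓢(V, F)) :
    ∂_{v} (ψ.compSubConstCLM ℂ a) = (∂_{v} ψ).compSubConstCLM ℂ a := by
  ext1 x
  rw [SchwartzMap.compSubConstCLM_apply, SchwartzMap.lineDerivOp_apply_eq_fderiv,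
    SchwartzMap.lineDerivOp_apply_eq_fderiv]
  exact congrArg (fun S => S v) (fderiv_comp_sub (𝕜 := ℝ) (f := ψ) a)

variable [InnerProductSpace ℝ V]

/-- The phase-space translation `ψ ↦ e^{i⟨k, x⟩} ψ(x - a)` of Schwartz functions. -/
noncomputable def weyl [NormedSpace ℂ F] (k a : V) : 𝓢(V, F) →L[ℂ] 𝓢(V, F) :=
  SchwartzMap.smulLeftCLM F (planeWave k) ∘L SchwartzMap.compSubConstCLM ℂ a

theorem weyl_apply [NormedSpace ℂ F] (k a : V) (ψ : 𝓢(V, F)) (x : V) :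
    weyl k a ψ x = planeWave k x • ψ (x - a) :=
  SchwartzMap.smulLeftCLM_apply_apply (hasTemperateGrowth_planeWave k) _ x

theorem weyl_injective [NormedSpace ℂ F] (k a : V) :
    Function.Injective (weyl k a : 𝓢(V, F) → 𝓢(V, F)) := by
  intro φ ψ h
  ext1 x
  have hx := DFunLike.congr_fun h (x + a)
  rw [weyl_apply, weyl_apply, add_sub_cancel_right] at hx
  refine smul_right_injective F (norm_ne_zero_iff.1 ?_) hx
  exact (norm_planeWave k (x + a)).trans_ne one_ne_zero

theorem lineDeriv_weyl [NormedSpace ℂ F] (k a v : V) (ψ : 𝓢(V, F)) :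
    ∂_{v} (weyl k a ψ) = weyl k a (∂_{v} ψ + ((inner ℝ k v : ℝ) * Complex.I) • ψ) := by
  ext1 x
  rw [weyl, ContinuousLinearMap.comp_apply, lineDeriv_smulLeft (hasTemperateGrowth_planeWave k),
    lineDeriv_compSubConst, fderiv_planeWave_apply, ← weyl, weyl_apply]
  simp only [SchwartzMap.compSubConstCLM_apply, add_apply, smul_apply, smul_add, smul_smul]

theorem smulLeft_weyl [NormedSpace ℂ F] {f : V → ℂ} (hf : f.HasTemperateGrowth) {c : ℂ} {a : V}
    (hfa : ∀ x, f x = f (x - a) + c) (k : V) (ψ : 𝓢(V, F)) :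
    SchwartzMap.smulLeftCLM F f (weyl k a ψ) =
      weyl k a (SchwartzMap.smulLeftCLM F f ψ + c • ψ) := by
  ext1 x
  rw [SchwartzMap.smulLeftCLM_apply_apply hf, weyl_apply, weyl_apply, add_apply, smul_apply,
    SchwartzMap.smulLeftCLM_apply_apply hf, ← add_smul, ← hfa, smul_comm]

variable [FiniteDimensional ℝ V] [MeasurableSpace V] [BorelSpace V] [InnerProductSpace ℂ F]

/-- The phase-space translation `ψ ↦ e^{i⟨k, x⟩} ψ(x - a)` of `L²`. -/
noncomputable def weylL2 (k a : V) :
    Lp F 2 (volume : Measure V) →L[ℂ] Lp F 2 (volume : Measure V) :=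
  mulCLM (memLp_planeWave k) ∘L (Lp.compMeasurePreservingₗᵢ ℂ (fun x : V => x - a)
    (measurePreserving_sub_right volume a)).toContinuousLinearMap

theorem weylL2_toL2 (k a : V) (ψ : 𝓢(V, F)) : weylL2 k a (toL2 ψ) = toL2 (weyl k a ψ) := by
  have hm := measurePreserving_sub_right (volume : Measure V) a
  have htranslate : Lp.compMeasurePreserving _ hm (toL2 ψ) = toL2 (ψ.compSubConstCLM ℂ a) := by
    refine Lp.ext ?_
    filter_upwards [Lp.coeFn_compMeasurePreserving (toL2 ψ) hm,
      coeFn_toL2 (ψ.compSubConstCLM ℂ a),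
      hm.quasiMeasurePreserving.ae_eq_comp (coeFn_toL2 ψ)] with x h1 h2 h3
    rw [h1, h2, h3]
    rfl
  exact (congrArg (mulCLM (memLp_planeWave k)) htranslate).trans
    (mulCLM_toL2 _ (hasTemperateGrowth_planeWave k) _)

end Weyl

/-! ## The Moyal product -/

section MoyalProduct

variable {n : ℕ} (Θ : Matrix (Fin n) (Fin n) ℝ)

/-- The row `Θ^{μ·}` of the matrix, as a vector. -/
noncomputable def euclideanRow (μ : Fin n) : MinkowskiSpace n := WithLp.toLp 2 (Θ μ)

theorem toEuclideanLin_apply_eq_inner (w : MinkowskiSpace n) (μ : Fin n) :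
    Matrix.toEuclideanLin Θ w μ = inner ℝ w (euclideanRow Θ μ) := by
  simp [euclideanRow, Matrix.toLpLin_apply, Matrix.mulVec, dotProduct, PiLp.inner_apply]

theorem inner_toEuclideanLin_right (v w : MinkowskiSpace n) :
    inner ℝ v (Matrix.toEuclideanLin Θ w) = inner ℝ (Matrix.toEuclideanLin Θᵀ v) w := by
  rw [← Matrix.conjTranspose_eq_transpose_of_trivial,
    Matrix.toEuclideanLin_conjTranspose_eq_adjoint, LinearMap.adjoint_inner_left]

theorem moyalProd_eq_fourier (f : MinkowskiSpace n → ℂ) (h : SpinorSchwartz n)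
    (x : MinkowskiSpace n) : moyalProd Θ f h x =
      ∫ w : MinkowskiSpace n, f (x - Real.pi • Matrix.toEuclideanLin Θ w) •
        (𝓕 (h.compSubConstCLM ℂ (-x))) w := by
  set G : MinkowskiSpace n → SpinorFibre n := fun w =>
    f (x - Real.pi • Matrix.toEuclideanLin Θ w) • (𝓕 (h.compSubConstCLM ℂ (-x))) w with hG
  have hpi : (Real.pi : ℂ) ≠ 0 := mod_cast Real.pi_ne_zero
  have hrescale (u : MinkowskiSpace n) :
      f (x - (1 / 2 : ℝ) • Matrix.toEuclideanLin Θ u) •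
        ∫ v : MinkowskiSpace n, Complex.exp (-(Complex.I * (inner ℝ u v : ℝ))) • h (x + v) =
      G ((2 * Real.pi)⁻¹ • u) := by
    simp only [hG]
    rw [map_smul, smul_smul, SchwartzMap.fourier_coe, Real.fourier_eq']
    congr 3
    · congr 1
      field_simp
    · funext v
      rw [SchwartzMap.compSubConstCLM_apply, sub_neg_eq_add, add_comm v, inner_smul_right,
        real_inner_comm]
      congr 2
      push_cast
      field_simp
  have hjacobian :
      |(((2 * Real.pi)⁻¹) ^ Module.finrank ℝ (MinkowskiSpace n))⁻¹| = (2 * Real.pi) ^ n := by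
    rw [finrank_euclideanSpace_fin, inv_pow, inv_inv, abs_of_pos (by positivity)]
  rw [moyalProd, integral_congr_ae (ae_of_all _ hrescale), Measure.integral_comp_smul, hjacobian,
    smul_smul, inv_mul_cancel₀ (by positivity), one_smul]

theorem integral_exp_smul_fourier (F : SpinorSchwartz n) (a : MinkowskiSpace n) :
    ∫ w : MinkowskiSpace n, Complex.exp (↑(2 * Real.pi * inner ℝ w a) * Complex.I) • (𝓕 F) w =
      F a := by
  rw [← Real.fourierInv_eq', ← SchwartzMap.fourierInv_coe, FourierTransform.fourierInv_fourier_eq]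

theorem moyalProd_planeWave (k : MinkowskiSpace n) (h : SpinorSchwartz n) :
    moyalProd Θ (planeWave k) h = weyl k ((1 / 2 : ℝ) • Matrix.toEuclideanLin Θᵀ k) h := by
  funext x
  set a := (1 / 2 : ℝ) • Matrix.toEuclideanLin Θᵀ k with ha
  have hvalue : h.compSubConstCLM ℂ (-x) (-a) = h (x - a) := by
    rw [SchwartzMap.compSubConstCLM_apply, sub_neg_eq_add, neg_add_eq_sub]
  rw [moyalProd_eq_fourier, weyl_apply, ← hvalue, ← integral_exp_smul_fourier, ← integral_smul]
  refine integral_congr_ae (ae_of_all _ fun w => ?_)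
  simp only [smul_smul, sub_eq_add_neg, planeWave_add]
  congr 2
  rw [planeWave, inner_neg_right, inner_smul_right, inner_toEuclideanLin_right, ha,
    inner_neg_right, inner_smul_right, real_inner_comm]
  congr 2
  push_cast
  ring

theorem moyalProd_smul_planeWave {a : MinkowskiSpace n} (ha : Matrix.toEuclideanLin Θ a = 0)
    (f : MinkowskiSpace n → ℂ) (h : MinkowskiSpace n → SpinorFibre n) (x : MinkowskiSpace n) :
    moyalProd Θ f (fun y => planeWave a y • h y) x = planeWave a x • moyalProd Θ f h x := by
  set J : MinkowskiSpace n → SpinorFibre n := fun u =>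
    ∫ v : MinkowskiSpace n, Complex.exp (-(Complex.I * (inner ℝ u v : ℝ))) • h (x + v) with hJ
  have hinner (u : MinkowskiSpace n) :
      (∫ v : MinkowskiSpace n, Complex.exp (-(Complex.I * (inner ℝ u v : ℝ))) •
        (planeWave a (x + v) • h (x + v))) = planeWave a x • J (u - a) := by
    rw [hJ, ← integral_smul]
    refine integral_congr_ae (ae_of_all _ fun v => ?_)
    simp only [planeWave_add, smul_smul]
    rw [mul_left_comm, planeWave, planeWave, ← Complex.exp_add, inner_sub_left]
    congr 3
    push_cast
    ring
  have hshift := integral_sub_right_eq_self (μ := (volume : Measure (MinkowskiSpace n)))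
    (fun u => f (x - (1 / 2 : ℝ) • Matrix.toEuclideanLin Θ u) • J u) a
  rw [moyalProd, moyalProd, smul_comm, ← hshift, ← integral_smul (planeWave a x)]
  refine congrArg _ (integral_congr_ae (ae_of_all _ fun u => ?_))
  simp only [hinner, map_sub, ha, sub_zero]
  rw [smul_comm]

theorem fourier_postcomp (T : SpinorFibre n →L[ℂ] SpinorFibre n) (h : SpinorSchwartz n)
    (w : MinkowskiSpace n) : 𝓕 (h.postcompCLM T) w = T (𝓕 h w) := by
  rw [SchwartzMap.fourier_coe, SchwartzMap.fourier_coe, Real.fourier_eq, Real.fourier_eq,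
    ← T.integral_comp_comm ((Real.fourierIntegral_convergent_iff w).2 h.integrable)]
  simp only [SchwartzMap.postcompCLM_apply, Circle.smul_def, map_smul]

theorem hasTemperateGrowth_comp_toEuclideanLin {f : MinkowskiSpace n → ℂ}
    (hf : f.HasTemperateGrowth) (x : MinkowskiSpace n) :
    (fun w => f (x - Real.pi • Matrix.toEuclideanLin Θ w)).HasTemperateGrowth := by
  have hlin : (fun w => (Matrix.toEuclideanLin Θ).toContinuousLinearMap w).HasTemperateGrowth := by
    fun_prop
  exact hf.comp ((Function.HasTemperateGrowth.const x).sub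
    ((Function.HasTemperateGrowth.const Real.pi).smul hlin))

theorem moyalProd_postcomp {f : MinkowskiSpace n → ℂ} (hf : f.HasTemperateGrowth)
    (T : SpinorFibre n →L[ℂ] SpinorFibre n) (h : SpinorSchwartz n) (x : MinkowskiSpace n) :
    moyalProd Θ f (h.postcompCLM T) x = T (moyalProd Θ f h x) := by
  have hint : Integrable (fun w : MinkowskiSpace n =>
      f (x - Real.pi • Matrix.toEuclideanLin Θ w) • (𝓕 (h.compSubConstCLM ℂ (-x))) w) := by
    refine (SchwartzMap.smulLeftCLM (SpinorFibre n) (fun w =>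
      f (x - Real.pi • Matrix.toEuclideanLin Θ w)) (𝓕 (h.compSubConstCLM ℂ (-x)))).integrable.congr
      (ae_of_all _ fun w => ?_)
    exact SchwartzMap.smulLeftCLM_apply_apply (hasTemperateGrowth_comp_toEuclideanLin Θ hf x) _ w
  have htranslate : (h.postcompCLM T).compSubConstCLM ℂ (-x) =
      (h.compSubConstCLM ℂ (-x)).postcompCLM T := rfl
  rw [moyalProd_eq_fourier, moyalProd_eq_fourier, ← T.integral_comp_comm hint, htranslate]
  simp only [fourier_postcomp, map_smul]

theorem hasTemperateGrowth_coord (μ : Fin n) :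
    (fun x : MinkowskiSpace n => x μ).HasTemperateGrowth :=
  (EuclideanSpace.proj (𝕜 := ℝ) μ).hasTemperateGrowth

/-- Left Moyal multiplication by the coordinate `x^μ`, that is, `x^μ + (i/2) Θ^{μν} ∂_ν`. -/
noncomputable def moyalCoord (μ : Fin n) : SpinorSchwartz n →L[ℂ] SpinorSchwartz n :=
  SchwartzMap.smulLeftCLM (SpinorFibre n) (fun x : MinkowskiSpace n => ((x μ : ℝ) : ℂ)) +
    (Complex.I / 2) • LineDeriv.lineDerivOpCLM ℂ (SpinorSchwartz n) (euclideanRow Θ μ)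

theorem moyalCoord_apply (μ : Fin n) (h : SpinorSchwartz n) (x : MinkowskiSpace n) :
    moyalCoord Θ μ h x =
      ((x μ : ℝ) : ℂ) • h x + (Complex.I / 2) • (∂_{euclideanRow Θ μ} h) x := by
  rw [moyalCoord, add_apply, add_apply, SchwartzMap.smulLeftCLM_apply_apply
    (hasTemperateGrowth_ofReal_comp (hasTemperateGrowth_coord μ))]
  rfl

theorem fourier_smul_add_lineDeriv (c d : ℂ) (v : MinkowskiSpace n) (F : SpinorSchwartz n)
    (w : MinkowskiSpace n) : 𝓕 (c • F + d • ∂_{v} F) w =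
      (c + d * (2 * Real.pi * Complex.I) * (inner ℝ w v : ℝ)) • 𝓕 F w := by
  have hv : (inner ℝ · v : MinkowskiSpace n → ℝ).HasTemperateGrowth := by fun_prop
  rw [FourierTransform.fourier_add, FourierTransform.fourier_smul, FourierTransform.fourier_smul,
    SchwartzMap.fourier_lineDerivOp_eq, add_apply, smul_apply, smul_apply, smul_apply,
    SchwartzMap.smulLeftCLM_apply_apply hv, ← Complex.coe_smul (inner ℝ w v), smul_smul, smul_smul,
    ← add_smul]

theorem moyalProd_coord (μ : Fin n) (h : SpinorSchwartz n) :
    moyalProd Θ (fun x => ((x μ : ℝ) : ℂ)) h = moyalCoord Θ μ h := by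
  funext x
  set F := h.compSubConstCLM ℂ (-x) with hF
  have hvalue : (((x μ : ℝ) : ℂ) • F + (Complex.I / 2) • ∂_{euclideanRow Θ μ} F) 0 =
      moyalCoord Θ μ h x := by
    rw [moyalCoord_apply, add_apply, smul_apply, smul_apply, hF, lineDeriv_compSubConst,
      SchwartzMap.compSubConstCLM_apply, SchwartzMap.compSubConstCLM_apply, sub_neg_eq_add,
      zero_add]
  rw [moyalProd_eq_fourier, ← hvalue, ← integral_exp_smul_fourier]
  refine integral_congr_ae (ae_of_all _ fun w => ?_)
  simp only [inner_zero_right, mul_zero, Complex.ofReal_zero, zero_mul, Complex.exp_zero, one_smul,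
    fourier_smul_add_lineDeriv, PiLp.sub_apply, PiLp.smul_apply, toEuclideanLin_apply_eq_inner,
    smul_eq_mul]
  congr 1
  push_cast
  linear_combination (-(Real.pi : ℂ) * (inner ℝ w (euclideanRow Θ μ) : ℝ)) * Complex.I_sq

theorem isSchwartzAdjoint_moyalCoord (μ : Fin n) :
    IsSchwartzAdjoint (moyalCoord Θ μ) (moyalCoord Θ μ) := by
  have hconj : star (Complex.I / 2) = -(Complex.I / 2) := by
    rw [star_div₀, Complex.star_def, Complex.conj_I, neg_div, map_ofNat]
  have h := (isSchwartzAdjoint_smulLeft (hasTemperateGrowth_coord μ)).add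
    ((isSchwartzAdjoint_lineDeriv (F := SpinorFibre n) (euclideanRow Θ μ)).smul (Complex.I / 2))
  rwa [hconj, neg_smul_neg] at h

theorem moyalCoord_weyl (μ : Fin n) (k : MinkowskiSpace n) (ψ : SpinorSchwartz n) :
    moyalCoord Θ μ (weyl k ((1 / 2 : ℝ) • Matrix.toEuclideanLin Θᵀ k) ψ) =
      weyl k ((1 / 2 : ℝ) • Matrix.toEuclideanLin Θᵀ k) (moyalCoord Θ μ ψ +
        ((1 / 2 * inner ℝ k (euclideanRow Θᵀ μ - euclideanRow Θ μ) : ℝ) : ℂ) • ψ) := by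
  set a := (1 / 2 : ℝ) • Matrix.toEuclideanLin Θᵀ k with ha
  have haμ : a μ = 1 / 2 * inner ℝ k (euclideanRow Θᵀ μ) := by
    rw [ha, PiLp.smul_apply, toEuclideanLin_apply_eq_inner, smul_eq_mul]
  have hshift (x : MinkowskiSpace n) :
      ((x μ : ℝ) : ℂ) = (((x - a) μ : ℝ) : ℂ) + ((a μ : ℝ) : ℂ) := by
    rw [← Complex.ofReal_add, PiLp.sub_apply, sub_add_cancel]
  simp only [moyalCoord, add_apply, smul_apply, LineDeriv.lineDerivOpCLM_apply]
  rw [lineDeriv_weyl, smulLeft_weyl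
    (hasTemperateGrowth_ofReal_comp (hasTemperateGrowth_coord μ)) hshift, ← map_smul, ← map_add]
  congr 1
  have hc : ((1 / 2 * inner ℝ k (euclideanRow Θᵀ μ - euclideanRow Θ μ) : ℝ) : ℂ) =
      ((a μ : ℝ) : ℂ) + Complex.I / 2 * ((inner ℝ k (euclideanRow Θ μ) : ℝ) * Complex.I) := by
    rw [haμ, inner_sub_right]
    push_cast
    linear_combination (-(1 / 2) * (inner ℝ k (euclideanRow Θ μ) : ℝ) : ℂ) * Complex.I_sq
  rw [hc]
  module

end MoyalProduct

/-! ## Commutative time forces `Θ^{0·}` to be symmetric -/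

theorem TemporalTriple.HasCommutativeTime.commutesWith_opMul_time {H : Type*}
    [NormedAddCommGroup H] [InnerProductSpace ℂ H] [CompleteSpace H] {t : TemporalTriple H}
    (h : t.HasCommutativeTime) {A : H →L[ℂ] H} (hA : A ∈ t.unitization) :
    CommutesWith A (opMul t.time t.time) := by
  obtain ⟨S, hS, hcomm⟩ := h
  have hAS := (hcomm A hA).1
  exact CommutesWith.of_id_vadd (hS.sq_eq ▸ hAS.opMul hAS)

section Necessity

variable {n : ℕ} {Θ : Matrix (Fin n) (Fin n) ℝ}

theorem isSmoothBounded_planeWave (k : MinkowskiSpace n) : IsSmoothBounded (planeWave k) :=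
  ⟨contDiff_planeWave k, fun m => ⟨_, norm_iteratedFDeriv_planeWave_le k m⟩⟩

theorem isLeftMoyal_planeWave (Θ : Matrix (Fin n) (Fin n) ℝ) (k : MinkowskiSpace n) :
    IsLeftMoyal Θ (planeWave k) (weylL2 k ((1 / 2 : ℝ) • Matrix.toEuclideanLin Θᵀ k)) :=
  fun ψ => by
    rw [moyalProd_planeWave]
    exact (weylL2_toL2 k _ ψ).symm ▸ coeFn_toL2 _

theorem smul_apply_add_sq_smul_eq_zero {L L' : SpinorSchwartz n →L[ℂ] SpinorSchwartz n}
    (hL : IsSchwartzAdjoint L L') {A : SpinorL2 n →L[ℂ] SpinorL2 n}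
    {W : SpinorSchwartz n → SpinorSchwartz n} (hW : Function.Injective W)
    (hA : ∀ ψ, A (toL2 ψ) = toL2 (W ψ)) {c : ℂ} (hLW : ∀ ψ, L (W ψ) = W (L ψ + c • ψ))
    (hcomm : CommutesWith A
      (opMul (closureOfSchwartzOp fun ψ => L ψ) (closureOfSchwartzOp fun ψ => L ψ)))
    (ψ : SpinorSchwartz n) : (2 * c) • L ψ + c ^ 2 • ψ = 0 := by
  have hsq (φ : SpinorSchwartz n) : (toL2 φ, toL2 (L (L φ))) ∈
      (opMul (closureOfSchwartzOp fun ψ => L ψ) (closureOfSchwartzOp fun ψ => L ψ)).graph :=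
    mem_graph_opMul_iff.2 ⟨_, toL2_mem_graph_closureOfSchwartzOp hL _,
      toL2_mem_graph_closureOfSchwartzOp hL _⟩
  have hgraph := commutesWith_iff_graph.1 hcomm _ _ (hsq ψ)
  rw [hA, hA] at hgraph
  have hLL : W (L (L ψ)) = L (L (W ψ)) :=
    SchwartzMap.injective_toLp 2 volume (LinearPMap.mem_graph_snd_inj _ hgraph (hsq (W ψ)) rfl)
  rw [hLW, hLW] at hLL
  have hshift := hW hLL
  rw [map_add, map_smul] at hshift
  linear_combination (norm := module) -hshift

theorem exists_spinorSchwartz_ne_zero (n : ℕ) : ∃ ψ : SpinorSchwartz n, ψ ≠ 0 := by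
  let b : ContDiffBump (0 : MinkowskiSpace n) := ⟨1, 2, one_pos, one_lt_two⟩
  let v : SpinorFibre n := EuclideanSpace.single ⟨0, by positivity⟩ 1
  have hsupp : HasCompactSupport fun x => b x • v := b.hasCompactSupport.smul_right
  refine ⟨hsupp.toSchwartzMap (b.contDiff.smul contDiff_const), fun h => ?_⟩
  have hv : b 0 • v = 0 := DFunLike.congr_fun h 0
  rw [b.one_of_mem_closedBall (Metric.mem_closedBall_self one_pos.le), one_smul] at hv
  simp [v] at hv

variable [NeZero n] {γ : Fin n → Matrix (Fin (2 ^ (n / 2))) (Fin (2 ^ (n / 2))) ℂ}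

theorem time_moyalMinkowski : (moyalMinkowski Θ γ).time =
    closureOfSchwartzOp fun ψ => moyalCoord Θ 0 ψ :=
  congrArg closureOfSchwartzOp (funext fun ψ => moyalProd_coord Θ 0 ψ)

theorem inner_euclideanRow_sub_eq_zero (h : (moyalMinkowski Θ γ).HasCommutativeTime)
    (k : MinkowskiSpace n) :
    inner ℝ k (euclideanRow Θᵀ 0 - euclideanRow Θ 0) = 0 := by
  set d := euclideanRow Θᵀ 0 - euclideanRow Θ 0
  obtain ⟨ψ, hψ⟩ := exists_spinorSchwartz_ne_zero n
  have hshift (k : MinkowskiSpace n) :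
      (2 * ((1 / 2 * inner ℝ k d : ℝ) : ℂ)) • moyalCoord Θ 0 ψ +
        ((1 / 2 * inner ℝ k d : ℝ) : ℂ) ^ 2 • ψ = 0 := by
    have hcomm := h.commutesWith_opMul_time
      ⟨planeWave k, isSmoothBounded_planeWave k, isLeftMoyal_planeWave Θ k⟩
    rw [time_moyalMinkowski] at hcomm
    exact smul_apply_add_sq_smul_eq_zero (isSchwartzAdjoint_moyalCoord Θ 0) (weyl_injective k _)
      (weylL2_toL2 k _) (moyalCoord_weyl Θ 0 k) hcomm ψ
  -- The shifts by `±k` differ in the sign of the linear term.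
  have hneg := hshift (-k)
  rw [inner_neg_left, mul_neg, Complex.ofReal_neg] at hneg
  have hsq : (2 * ((1 / 2 * inner ℝ k d : ℝ) : ℂ) ^ 2) • ψ = 0 := by
    linear_combination (norm := module) hshift k + hneg
  have hzero := (smul_eq_zero.1 hsq).resolve_right hψ
  simpa using hzero

theorem theta_symm_of_hasCommutativeTime (h : (moyalMinkowski Θ γ).HasCommutativeTime)
    (μ : Fin n) : Θ μ 0 = Θ 0 μ := by
  have hd := sub_eq_zero.1 (inner_self_eq_zero.1 (inner_euclideanRow_sub_eq_zero h _))
  exact congrArg (· μ) hd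

end Necessity

/-! ## Left Moyal multiplication commutes with functions of a central coordinate -/

theorem IsSmoothBounded.hasTemperateGrowth {n : ℕ} {f : MinkowskiSpace n → ℂ}
    (hf : IsSmoothBounded f) : f.HasTemperateGrowth :=
  ⟨hf.1, fun m => (hf.2 m).elim fun C hC => ⟨0, C, fun x => by
    rw [pow_zero, mul_one]
    exact hC x⟩⟩

theorem compLpL_toL2 {V F : Type*} [NormedAddCommGroup V] [InnerProductSpace ℝ V]
    [FiniteDimensional ℝ V] [MeasurableSpace V] [BorelSpace V] [NormedAddCommGroup F]
    [InnerProductSpace ℂ F] (T : F →L[ℂ] F) (ψ : 𝓢(V, F)) :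
    T.compLpL 2 volume (toL2 ψ) = toL2 (ψ.postcompCLM T) := by
  refine Lp.ext ?_
  filter_upwards [T.coeFn_compLpL (toL2 ψ), coeFn_toL2 ψ, coeFn_toL2 (ψ.postcompCLM T)]
    with x h1 h2 h3
  rw [h1, h2, h3, SchwartzMap.postcompCLM_apply]

section LeftMoyal

variable {n : ℕ} {Θ : Matrix (Fin n) (Fin n) ℝ} {f : MinkowskiSpace n → ℂ}
  {A : SpinorL2 n →L[ℂ] SpinorL2 n}

theorem commute_of_forall_toL2 {B : SpinorL2 n →L[ℂ] SpinorL2 n}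
    (h : ∀ φ : SpinorSchwartz n, A (B (toL2 φ)) = B (A (toL2 φ))) : Commute A B :=
  ContinuousLinearMap.coeFn_injective (denseRange_toL2.equalizer (A * B).continuous
    (B * A).continuous (funext h))

theorem IsLeftMoyal.commutesWith_planeWave (hA : IsLeftMoyal Θ f A) {a : MinkowskiSpace n}
    (ha : Matrix.toEuclideanLin Θ a = 0) : CommutesWith A (mulOp (planeWave a)) := by
  refine (commutesWith_mulOp_iff (memLp_planeWave a)).2 (commute_of_forall_toL2 fun φ => ?_)
  have hp := hasTemperateGrowth_planeWave a
  have hφ : ⇑(SchwartzMap.smulLeftCLM (SpinorFibre n) (planeWave a) φ) =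
      fun y => planeWave a y • φ y :=
    funext fun y => SchwartzMap.smulLeftCLM_apply_apply hp φ y
  have hmul := hA (SchwartzMap.smulLeftCLM (SpinorFibre n) (planeWave a) φ)
  rw [hφ] at hmul
  rw [mulCLM_toL2 _ hp]
  refine Lp.ext ?_
  filter_upwards [hA φ, hmul, coeFn_mulCLM (memLp_planeWave a) (A (toL2 φ))] with x h1 h2 h3
  exact h2.trans ((moyalProd_smul_planeWave Θ ha f φ x).trans
    ((congrArg _ h1.symm).trans h3.symm))

theorem IsLeftMoyal.commute_compLpL (hA : IsLeftMoyal Θ f A) (hf : f.HasTemperateGrowth)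
    (T : SpinorFibre n →L[ℂ] SpinorFibre n) : Commute A (T.compLpL 2 volume) := by
  refine commute_of_forall_toL2 fun φ => ?_
  rw [compLpL_toL2]
  refine Lp.ext ?_
  filter_upwards [hA φ, hA (φ.postcompCLM T), T.coeFn_compLpL (A (toL2 φ))] with x h1 h2 h3
  exact h2.trans ((moyalProd_postcomp Θ hf T φ x).trans ((congrArg T h1.symm).trans h3.symm))

theorem planeWave_smul_single (μ : Fin n) (k : ℝ) (x : MinkowskiSpace n) :
    planeWave (k • EuclideanSpace.single μ 1) x = Complex.exp ((k * x μ : ℝ) * Complex.I) := by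
  rw [planeWave, inner_smul_left, EuclideanSpace.inner_single_left, map_one, one_mul]
  rfl

theorem IsLeftMoyal.commutesWith_mulOp_coord (hA : IsLeftMoyal Θ f A) {μ : Fin n}
    (hΘ : ∀ ν, Θ ν μ = 0) {g : ℝ → ℂ} (hg : ContDiff ℝ ∞ g) :
    CommutesWith A (mulOp fun x => g (x μ)) := by
  refine commutesWith_mulOp_comp (EuclideanSpace.proj (𝕜 := ℝ) μ).continuous.measurable
    (fun k => ?_) hg
  have hker : Matrix.toEuclideanLin Θ (k • EuclideanSpace.single μ 1) = 0 := by
    ext ν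
    simp [Matrix.toLpLin_apply, hΘ ν]
  have hwave := hA.commutesWith_planeWave hker
  rwa [funext (planeWave_smul_single μ k)] at hwave

end LeftMoyal

theorem commute_symbolCLM {ι V F : Type*} [Fintype ι] [NormedAddCommGroup V]
    [InnerProductSpace ℝ V] [FiniteDimensional ℝ V] [MeasurableSpace V] [BorelSpace V]
    [NormedAddCommGroup F] [InnerProductSpace ℂ F] {g : ι → V → ℝ}
    {hg : ∀ j, MemLp (fun x => (g j x : ℂ)) ∞ volume} {T : ι → F →L[ℂ] F}
    {A : Lp F 2 (volume : Measure V) →L[ℂ] Lp F 2 (volume : Measure V)}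
    (hmul : ∀ j, Commute A (mulCLM (hg j))) (hfibre : ∀ j, Commute A ((T j).compLpL 2 volume)) :
    Commute A (symbolCLM hg T) :=
  (Commute.sum_right _ _ _ fun j _ => (hfibre j).mul_right (hmul j)).smul_right _

/-! ## `Θ^{0·} = 0` implies commutative time -/

section Sufficiency

variable {n : ℕ}

theorem hasDerivAt_japaneseBracket (t : ℝ) :
    HasDerivAt japaneseBracket (t * (japaneseBracket t)⁻¹) t := by
  have h := ((hasDerivAt_pow 2 t).const_add 1).sqrt (by positivity)
  refine h.congr_deriv ?_
  rw [Nat.cast_ofNat, pow_one, mul_div_mul_left _ _ two_ne_zero, div_eq_mul_inv, japaneseBracket]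

theorem fderiv_japaneseBracket_coord (μ : Fin n) (x v : MinkowskiSpace n) :
    fderiv ℝ (fun x : MinkowskiSpace n => japaneseBracket (x μ)) x v =
      x μ * (japaneseBracket (x μ))⁻¹ * v μ := by
  have h := (hasDerivAt_japaneseBracket (x μ)).comp_hasFDerivAt x
    (EuclideanSpace.proj (𝕜 := ℝ) μ).hasFDerivAt
  exact congrArg (fun S => S v) h.fderiv

theorem memLp_fderiv_japaneseBracket_coord (μ : Fin n) (v : MinkowskiSpace n) :
    MemLp (fun x => ((fderiv ℝ (fun x : MinkowskiSpace n => japaneseBracket (x μ)) x v : ℝ) : ℂ))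
      ∞ volume := by
  have hcoord : AEStronglyMeasurable (fun x : MinkowskiSpace n => x μ) volume :=
    (hasTemperateGrowth_coord μ).1.continuous.aestronglyMeasurable
  simpa only [fderiv_japaneseBracket_coord, Complex.ofReal_mul] using
    (memLp_mul_inv_japaneseBracket hcoord).mul_const ((v μ : ℝ) : ℂ)

theorem flatDirac_eq_firstOrderOp
    (γ : Fin n → Matrix (Fin (2 ^ (n / 2))) (Fin (2 ^ (n / 2))) ℂ) (ψ : SpinorSchwartz n) :
    flatDirac γ ψ = firstOrderOp (fun μ => EuclideanSpace.single μ 1)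
      (fun μ => Matrix.toEuclideanCLM (𝕜 := ℂ) (γ μ)) ψ := by
  funext x
  simp only [flatDirac, firstOrderOp_apply, SchwartzMap.lineDerivOp_apply_eq_fderiv]
  rfl

variable {Θ : Matrix (Fin n) (Fin n) ℝ}

theorem moyalCoord_of_row_eq_zero {μ : Fin n} (hΘ : ∀ ν, Θ μ ν = 0) :
    moyalCoord Θ μ =
      SchwartzMap.smulLeftCLM (SpinorFibre n) fun x : MinkowskiSpace n => ((x μ : ℝ) : ℂ) := by
  have hrow : euclideanRow Θ μ = 0 := congrArg (WithLp.toLp 2) (funext hΘ)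
  ext1 ψ
  rw [moyalCoord, hrow, add_apply, smul_apply, LineDeriv.lineDerivOpCLM_apply,
    LineDeriv.lineDerivOp_left_zero, smul_zero, add_zero]

theorem IsLeftMoyal.commute_mulCLM_fderiv_japaneseBracket_coord {f : MinkowskiSpace n → ℂ}
    {A : SpinorL2 n →L[ℂ] SpinorL2 n} (hA : IsLeftMoyal Θ f A) {μ : Fin n}
    (hΘ : ∀ ν, Θ ν μ = 0) (v : MinkowskiSpace n) :
    Commute A (mulCLM (memLp_fderiv_japaneseBracket_coord μ v)) := by
  have hg : (fun t : ℝ => ((t * (japaneseBracket t)⁻¹ * v μ : ℝ) : ℂ)).HasTemperateGrowth :=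
    hasTemperateGrowth_ofReal_comp ((Function.HasTemperateGrowth.id'.mul
      hasTemperateGrowth_inv_japaneseBracket).mul (Function.HasTemperateGrowth.const _))
  rw [← commutesWith_mulOp_iff]
  simpa only [fderiv_japaneseBracket_coord] using hA.commutesWith_mulOp_coord hΘ hg.1

variable [NeZero n] {γ : Fin n → Matrix (Fin (2 ^ (n / 2))) (Fin (2 ^ (n / 2))) ℂ}

theorem time_moyalMinkowski_eq_mulOp (hΘ : ∀ μ, Θ 0 μ = 0) :
    (moyalMinkowski Θ γ).time = mulOp fun x => ((x 0 : ℝ) : ℂ) := by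
  rw [time_moyalMinkowski, moyalCoord_of_row_eq_zero hΘ]
  exact closureOfSchwartzOp_smulLeft_eq_mulOp (hasTemperateGrowth_coord 0)

theorem dirac_moyalMinkowski : (moyalMinkowski Θ γ).dirac =
    closureOfSchwartzOp fun ψ => firstOrderOp (fun μ => EuclideanSpace.single μ 1)
      (fun μ => Matrix.toEuclideanCLM (𝕜 := ℂ) (γ μ)) ψ :=
  congrArg closureOfSchwartzOp (funext (flatDirac_eq_firstOrderOp γ))

theorem hasCommutativeTime_of_theta_eq_zero (hrow : ∀ μ, Θ 0 μ = 0) (hcol : ∀ μ, Θ μ 0 = 0) :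
    (moyalMinkowski Θ γ).HasCommutativeTime := by
  have hx0 := hasTemperateGrowth_coord (0 : Fin n)
  have hbracket := hasTemperateGrowth_ofReal_comp hasTemperateGrowth_japaneseBracket
  refine ⟨mulOp fun x => ((japaneseBracket (x 0) : ℝ) : ℂ), ?_, ?_⟩
  · rw [time_moyalMinkowski_eq_mulOp hrow]
    exact isSqrtOneAddSq_mulOp hx0.1.continuous.aestronglyMeasurable
  rintro A ⟨f, hf, hA⟩
  have hS := hA.commutesWith_mulOp_coord hcol hbracket.1
  refine ⟨hS, ?_⟩
  rw [dirac_moyalMinkowski, opCommutator_firstOrderOp_mulOp (f := fun x => japaneseBracket (x 0))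
    (hasTemperateGrowth_japaneseBracket.comp hx0)
    (fun μ => memLp_fderiv_japaneseBracket_coord 0 _), commutesWith_toPMap_top_iff]
  exact commute_symbolCLM (fun μ => hA.commute_mulCLM_fderiv_japaneseBracket_coord hcol _)
    fun μ => hA.commute_compLpL hf.hasTemperateGrowth _

end Sufficiency

theorem mainTheorem4_general (n : ℕ) [NeZero n] (Θ : Matrix (Fin n) (Fin n) ℝ)
    (hΘ : ∀ μ, Θ μ 0 = -Θ 0 μ)
    (γ : Fin n → Matrix (Fin (2 ^ (n / 2))) (Fin (2 ^ (n / 2))) ℂ) :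
    (moyalMinkowski Θ γ).HasCommutativeTime ↔ ∀ μ : Fin n, Θ 0 μ = 0 ∧ Θ μ 0 = 0 := by
  refine ⟨fun h μ => ?_, fun h =>
    hasCommutativeTime_of_theta_eq_zero (fun μ => (h μ).1) fun μ => (h μ).2⟩
  have hsymm := theta_symm_of_hasCommutativeTime h μ
  have hskew := hΘ μ
  constructor <;> linarith

theorem mainTheorem4 (n : ℕ) [NeZero n] (Θ : Matrix (Fin n) (Fin n) ℝ) (hΘ : Θᵀ = -Θ)
    (γ : Fin n → Matrix (Fin (2 ^ (n / 2))) (Fin (2 ^ (n / 2))) ℂ) (hγ : IsDiracMatrices γ) :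
    (moyalMinkowski Θ γ).HasCommutativeTime ↔ ∀ μ : Fin n, Θ 0 μ = 0 ∧ Θ μ 0 = 0 :=
  mainTheorem4_general n Θ (fun μ => congrFun (congrFun hΘ 0) μ) γ
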